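/- Consider a market in which agents of two types, $H$ (hard-to-match) and $E$ (easy-to-match), arrive according to independent Poisson processes with rates $\lambda_H>0$ and $\lambda_E>0$. When an agent arrives, directed compatibility edges between her and each agent waiting in the market are drawn independently: an agent of type $T\in\{H,E\}$ finds the item of any other agent compatible with probability $p_T$, where $p_H,p_E\in(0,1]$. Two agents can exchange (form a cycle of length two) if each finds the item of the other compatible. Under the policy BilateralMatch(H), a newly arrived agent is matched at once with a waiting agent with whom she forms a cycle of length two, if there is one; if there are several, waiting $H$ agents have priority, and further ties are broken uniformly at random. Both matched agents leave the market immediately; an agent who is not matched upon arrival waits in the market until she is matched. The numbers of waiting $H$ and $E$ agents form a continuous-time Markov chain on $\mathbb{N}^2$, which has a unique stationary distribution (steady state). Let $w_H=w_H(\lambda_H,\lambda_E,p_H,p_E)$ be the average waiting time (departure time minus arrival time) in steady state of $H$ agents, that is, the expected waiting time of an $H$ agent who arrives when the market is in steady state. Then, for fixed $\lambda_H,\lambda_E>0$ and $p_E\in(0,1]$: - if $\lambda_H<\lambda_E$, then $\displaystyle\lim_{p_H\to0^+}p_H\,w_H=\frac{1}{p_E\lambda_H}\ln\Big(\frac{\lambda_E}{\lambda_E-\lambda_H}\Big)$;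 - if $\lambda_H>\lambda_E$, then $\displaystyle\lim_{p_H\to0^+}p_H^2\,w_H=\frac{1}{\lambda_H}\ln\Big(\frac{2\lambda_H}{\lambda_H+\lambda_E}\Big)$. -/

import Mathlib

open Filter Topology

/-- The two types of agents: hard-to-match and easy-to-match. -/
inductive AgentType where
  | H
  | E
  deriving DecidableEq

namespace BilateralH

/-- Parameters of the market: arrival rates of the two types, and the probability with which an
agent of a given type finds the item of another agent compatible. -/
structure Params where
  lamH : ℝ
  lamE : ℝ
  pH : ℝ
  pE : ℝ

/-- Arrival rate of agents of a given type. -/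
def Params.lam (P : Params) : AgentType → ℝ
  | .H => P.lamH
  | .E => P.lamE

/-- Probability that an agent of the given type finds a given item compatible. -/
def Params.prob (P : Params) : AgentType → ℝ
  | .H => P.pH
  | .E => P.pE

/-- Total arrival rate. -/
def Params.total (P : Params) : ℝ := P.lamH + P.lamE

/-! ### One arrival under the policy

`ι` labels the agents who are waiting, `typ` gives their types. Upon an arrival, directed
compatibility edges are drawn between the newcomer and each waiting agent `i`: `(ω i).1` says that
the newcomer finds the item of `i` compatible, `(ω i).2` says that `i` finds the item of the
newcomer compatible. Edges between two waiting agents play no role in the policy. -/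

/-- Probability of the outcome `b` of a coin which shows `true` with probability `p`. -/
def coinProb (p : ℝ) (b : Bool) : ℝ := if b then p else 1 - p

/-- Probability of the edge configuration `ω` when an agent of type `T` arrives (all edges are
independent). -/
def edgeProb {ι : Type} [Fintype ι] (P : Params) (typ : ι → AgentType) (T : AgentType)
    (ω : ι → Bool × Bool) : ℝ :=
  ∏ i, coinProb (P.prob T) (ω i).1 * coinProb (P.prob (typ i)) (ω i).2

/-- The waiting agents that form a cycle of length two with the newcomer. -/
def cycles {ι : Type} [Fintype ι] (ω : ι → Bool × Bool) : Finset ι :=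
  Finset.univ.filter fun i => (ω i).1 = true ∧ (ω i).2 = true

/-- Priority to `H`: if the newcomer forms a two-cycle with an `H` agent, only `H` agents are
considered; otherwise all agents forming a two-cycle with the newcomer are. -/
def candidates {ι : Type} [Fintype ι] (typ : ι → AgentType) (ω : ι → Bool × Bool) : Finset ι :=
  if ((cycles ω).filter fun i => typ i = AgentType.H).Nonempty then
    (cycles ω).filter fun i => typ i = AgentType.H
  else cycles ω

/-- The partner of the newcomer is uniform among the candidates (`none`: there is no candidate). -/
noncomputable def choiceProb {ι : Type} [DecidableEq ι] (c : Finset ι) : Option ι → ℝ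
  | none => if c = ∅ then 1 else 0
  | some i => if i ∈ c then (c.card : ℝ)⁻¹ else 0

/-- Probability that an arriving agent of type `T` is matched with the waiting agent `i`
(outcome `some i`; both leave at once), or with nobody (outcome `none`; the newcomer waits). -/
noncomputable def matchProb {ι : Type} [Fintype ι] [DecidableEq ι] (P : Params)
    (typ : ι → AgentType) (T : AgentType) (o : Option ι) : ℝ :=
  ∑ ω : ι → Bool × Bool, edgeProb P typ T ω * choiceProb (candidates typ ω) o

/-- Types of the waiting agents in a market with `h` agents of type `H` and `e` of type `E`. -/
def waitingType (h e : ℕ) : Fin h ⊕ Fin e → AgentType :=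
  Sum.elim (fun _ => AgentType.H) (fun _ => AgentType.E)

/-- Probability that an arriving agent of type `T` is not matched upon arrival. -/
noncomputable def joinProb (P : Params) (T : AgentType) (h e : ℕ) : ℝ :=
  matchProb P (waitingType h e) T none

/-- Probability that an arriving agent of type `T` is matched with a waiting `H` agent. -/
noncomputable def matchHProb (P : Params) (T : AgentType) (h e : ℕ) : ℝ :=
  ∑ i : Fin h, matchProb P (waitingType h e) T (some (Sum.inl i))

/-- Probability that an arriving agent of type `T` is matched with a waiting `E` agent. -/
noncomputable def matchEProb (P : Params) (T : AgentType) (h e : ℕ) : ℝ :=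
  ∑ j : Fin e, matchProb P (waitingType h e) T (some (Sum.inr j))

/-! ### The continuous-time Markov chain and its steady state -/

/-- Transition rate from `x = (h, e)` to `y`, where `h`, `e` are the numbers of waiting agents. -/
noncomputable def transitionRate (P : Params) (x y : ℕ × ℕ) : ℝ :=
  if y = (x.1 + 1, x.2) then P.lam .H * joinProb P .H x.1 x.2
  else if y = (x.1, x.2 + 1) then P.lam .E * joinProb P .E x.1 x.2
  else if x = (y.1 + 1, y.2) then
    P.lam .H * matchHProb P .H x.1 x.2 + P.lam .E * matchHProb P .E x.1 x.2
  else if x = (y.1, y.2 + 1) then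
    P.lam .H * matchEProb P .H x.1 x.2 + P.lam .E * matchEProb P .E x.1 x.2
  else 0

/-- `π` is a stationary distribution of the chain: a probability distribution on `ℕ × ℕ` for which
the flow out of every state equals the flow into it. -/
structure IsSteadyState (P : Params) (π : ℕ × ℕ → ℝ) : Prop where
  nonneg : ∀ x, 0 ≤ π x
  sum_one : HasSum π 1
  balance : ∀ x, HasSum (fun y => π y * transitionRate P y x) (π x * ∑' y, transitionRate P x y)

/-! ### Waiting times of `H` agents -/

/-- One arrival seen by a tagged `H` agent who is waiting together with `h` other `H` agents and `e`
agents of type `E`; the tagged agent has the label `Fin.last h`. The arrival is of type `T` with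
probability `P.lam T / P.total`. The newcomer may join the market, or be matched with another `H`
agent, with an `E` agent, or with the tagged agent. The value is the mean of `f` at the new numbers
of other agents, counted as zero if the tagged agent has left. -/
noncomputable def taggedStep (P : Params) (f : ℕ → ℕ → ℝ) (h e : ℕ) : ℝ :=
  P.lam .H / P.total * (joinProb P .H (h + 1) e * f (h + 1) e + matchOther .H)
    + P.lam .E / P.total * (joinProb P .E (h + 1) e * f h (e + 1) + matchOther .E)
where
  /-- The part in which a newcomer of type `T` is matched with an agent other than the tagged one. -/
  matchOther (T : AgentType) : ℝ :=
    (∑ i : Fin h, matchProb P (waitingType (h + 1) e) T (some (Sum.inl i.castSucc))) * f (h - 1) e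
      + matchEProb P T (h + 1) e * f h (e - 1)

/-- Probability that an `H` agent who is waiting together with `h` other `H` agents and `e` agents
of type `E` is still waiting after the next `n` arrivals. -/
noncomputable def stayProb (P : Params) : ℕ → ℕ → ℕ → ℝ
  | 0 => fun _ _ => 1
  | n + 1 => taggedStep P (stayProb P n)

/-- Probability that the waiting time of an `H` agent who arrives in steady state exceeds `t`. She
finds the market in a state `(h, e)` distributed according to `π`, has to wait if she is not matched
upon arrival, and the number of arrivals in the next `t` units of time is Poisson with mean
`P.total * t`. -/
noncomputable def waitTail (P : Params) (π : ℕ × ℕ → ℝ) (t : ℝ) : ℝ :=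
  ∑' x : ℕ × ℕ, π x * (joinProb P .H x.1 x.2 *
    ∑' n : ℕ, Real.exp (-(P.total * t)) * (P.total * t) ^ n / (n.factorial : ℝ)
      * stayProb P n x.1 x.2)

/-- Average waiting time of `H` agents in the steady state `π`: the mean `∫₀^∞ P(W > t) dt` of the
waiting time `W`. -/
noncomputable def avgWait (P : Params) (π : ℕ × ℕ → ℝ) : ENNReal :=
  ∫⁻ t in Set.Ioi (0 : ℝ), ENNReal.ofReal (waitTail P π t)

end BilateralH

/-!
The total transition rate out of every state is `lamH + lamE`, so the market is a uniformised jump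
chain on pairs `(h, e)` of numbers of waiting `H` and `E` agents. A newcomer joins with a
probability that decays geometrically in `h + e`; this gives a Foster-Lyapunov function of
`h + e`, hence a stationary distribution (`existsUnique_isSteadyState`; uniqueness holds as
every state leads to the empty market), and exponential moments of it (`IsSteadyState.summable_two_pow`).
Consequently the mean drift `∑ π x * gen P f x` vanishes for every nonnegative `f` of quadratic growth
(`IsSteadyState.hasSum_gen`).

The average waiting time of `H` agents equals `E h / lamH` by Little's law (`avgWait_eq`): the mean
number of `H` agents who are present and stay for `n` further arrivals telescopes in `n`.

It remains to locate `h` in steady state. The drift of `e ^ 2` shows that an `H` newcomer is matched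
with a waiting `E` agent with probability of order `√pH` only (`IsSteadyState.tsum_matchHE_le`). Up
to this, the number `h` increases at rate `lamH * A` and decreases at rate
`lamH * (1 - A) + lamE * (1 - C)`, where `A = (1 - pH ^ 2) ^ h` and `C = (1 - pE * pH) ^ h`.
* If `lamH < lamE`, then `h` is of order `1 / pH`, so that `A ≈ 1`, and the drift is approximately
  `lamE * (C - (lamE - lamH) / lamE)`.
* If `lamH > lamE`, then `h` is of order `1 / pH ^ 2`, so that `C ≈ 0`, and the drift is
  approximately `2 * lamH * (A - (lamH + lamE) / (2 * lamH))`.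
In both cases the drift has the form `a * ((1 - θ) ^ h - exp (-ℓ))` with `θ = pE * pH`, respectively
`θ = pH ^ 2`, which pulls `h` towards the value `s ≈ ℓ / θ` where it vanishes. As the mean drift of
`(h - s) ^ 2` is zero, the restoring force `θ * (s - h) * ((1 - θ) ^ h - exp (-ℓ))` has a small
mean, and therefore `θ * E h` tends to `ℓ` (`IsSteadyState.abs_mean_sub_le`).
-/

namespace BilateralH

/-! ### Matching probabilities of a newcomer -/

/-- Probability that a newcomer of type `T` forms no two-cycle with any of `n` agents of
type `S`. -/
def missProb (P : Params) (T S : AgentType) (n : ℕ) : ℝ := (1 - P.prob T * P.prob S) ^ n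

section Edges

variable {ι : Type} [Fintype ι] (P : Params) (typ : ι → AgentType) (T : AgentType)

lemma cycles_filter_nonempty_iff (ω : ι → Bool × Bool) :
    ((cycles ω).filter fun i => typ i = AgentType.H).Nonempty ↔
      ¬ ∀ i, typ i = AgentType.H → i ∉ cycles ω := by
  simp only [Finset.Nonempty, Finset.mem_filter]
  push Not
  exact exists_congr fun i => and_comm

lemma candidates_eq_empty_iff (ω : ι → Bool × Bool) :
    candidates typ ω = ∅ ↔ ∀ i, True → i ∉ cycles ω := by
  unfold candidates
  split_ifs with h
  · refine iff_of_false h.ne_empty fun h' => ?_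
    obtain ⟨i, hi⟩ := h
    exact h' i trivial (Finset.mem_filter.1 hi).1
  · simp [Finset.eq_empty_iff_forall_notMem]

variable [DecidableEq ι]

/-- Probability that the newcomer forms no two-cycle with an agent in `S`, by independence of the
edges. -/
lemma sum_edgeProb_avoid (S : ι → Prop) [DecidablePred S] :
    ∑ ω, edgeProb P typ T ω * (if ∀ i, S i → i ∉ cycles ω then 1 else 0)
      = ∏ i, if S i then 1 - P.prob T * P.prob (typ i) else 1 := by
  have h1 : ∀ i, (if S i then 1 - P.prob T * P.prob (typ i) else 1)
      = ∑ b : Bool × Bool, coinProb (P.prob T) b.1 * coinProb (P.prob (typ i)) b.2 *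
          (if S i → ¬ (b.1 = true ∧ b.2 = true) then 1 else 0) := by
    intro i
    by_cases hi : S i <;> simp [Fintype.sum_prod_type, coinProb, hi] <;> ring
  simp_rw [h1]
  rw [Finset.prod_univ_sum, Fintype.piFinset_univ]
  refine Finset.sum_congr rfl fun ω _ => ?_
  rw [Finset.prod_mul_distrib, edgeProb]
  congr 1
  rw [Finset.prod_ite_zero]
  simp [cycles]

lemma sum_edgeProb : ∑ ω, edgeProb P typ T ω = 1 := by
  simpa using sum_edgeProb_avoid P typ T (fun _ => False)

lemma sum_choiceProb_some (c : Finset ι) :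
    ∑ i, choiceProb c (some i) = if c = ∅ then 0 else 1 := by
  simp only [choiceProb, Finset.sum_ite_mem, Finset.univ_inter, Finset.sum_const, nsmul_eq_mul]
  split_ifs with h
  · simp [h]
  · exact mul_inv_cancel₀ (by simpa using h)

lemma matchProb_none : matchProb P typ T none = ∏ i, (1 - P.prob T * P.prob (typ i)) := by
  have h := sum_edgeProb_avoid P typ T (fun _ => True)
  simp only [if_true] at h
  rw [← h, matchProb]
  refine Finset.sum_congr rfl fun ω _ => ?_
  simp only [choiceProb, candidates_eq_empty_iff]

lemma matchProb_none_add_sum : matchProb P typ T none + ∑ i, matchProb P typ T (some i) = 1 := by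
  unfold matchProb
  rw [Finset.sum_comm, ← Finset.sum_add_distrib, ← sum_edgeProb P typ T]
  refine Finset.sum_congr rfl fun ω _ => ?_
  rw [← Finset.mul_sum, ← mul_add, sum_choiceProb_some]
  simp only [choiceProb]
  split_ifs <;> simp

/-- The policy treats agents of the same type alike. -/
lemma matchProb_some_perm (σ : Equiv.Perm ι) (hσ : ∀ i, typ (σ i) = typ i) (i : ι) :
    matchProb P typ T (some (σ i)) = matchProb P typ T (some i) := by
  have hcyc : ∀ (ω : ι → Bool × Bool) j, j ∈ cycles (ω ∘ σ) ↔ σ j ∈ cycles ω := by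
    intro ω j; simp [cycles]
  have hmem : ∀ (ω : ι → Bool × Bool) j,
      j ∈ candidates typ (ω ∘ σ) ↔ σ j ∈ candidates typ ω := by
    intro ω j
    have hne : ((cycles (ω ∘ σ)).filter fun i => typ i = AgentType.H).Nonempty ↔
        ((cycles ω).filter fun i => typ i = AgentType.H).Nonempty := by
      rw [cycles_filter_nonempty_iff, cycles_filter_nonempty_iff, not_iff_not,
        ← σ.forall_congr_right (q := fun i => typ i = AgentType.H → i ∉ cycles ω)]
      simp [hcyc, hσ]
    unfold candidates
    simp only [hne]
    split_ifs <;> simp [hcyc, hσ]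
  have hmap : ∀ ω : ι → Bool × Bool,
      (candidates typ (ω ∘ σ)).map σ.toEmbedding = candidates typ ω := by
    intro ω
    ext j
    obtain ⟨k, rfl⟩ := σ.surjective j
    rw [← hmem]
    simp
  have hcard : ∀ ω : ι → Bool × Bool,
      (candidates typ (ω ∘ σ)).card = (candidates typ ω).card := by
    intro ω
    rw [← hmap ω, Finset.card_map]
  unfold matchProb
  refine Fintype.sum_equiv (Equiv.arrowCongr σ.symm (Equiv.refl _)) _ _ fun ω => ?_
  have he : (Equiv.arrowCongr σ.symm (Equiv.refl (Bool × Bool))) ω = ω ∘ σ := by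
    ext j <;> simp [Equiv.arrowCongr]
  rw [he]
  congr 1
  · unfold edgeProb
    rw [← Equiv.prod_comp σ]
    simp [hσ]
  · simp only [choiceProb, hmem, hcard]

end Edges

section Totals

variable (P : Params) (T : AgentType)

lemma joinProb_eq (h e : ℕ) :
    joinProb P T h e = missProb P T .H h * missProb P T .E e := by
  simp [joinProb, matchProb_none, waitingType, missProb]

lemma matchHProb_eq (h e : ℕ) : matchHProb P T h e = 1 - missProb P T .H h := by
  have h1 := sum_edgeProb_avoid P (waitingType h e) T
    (fun i => waitingType h e i = AgentType.H)
  have h2 : (∏ i, if waitingType h e i = AgentType.H then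
      1 - P.prob T * P.prob (waitingType h e i) else 1) = missProb P T .H h := by
    simp [waitingType, missProb]
  rw [h2] at h1
  rw [← h1, eq_sub_iff_add_eq, matchHProb]
  refine Eq.trans ?_ (sum_edgeProb P (waitingType h e) T)
  unfold matchProb
  rw [Finset.sum_comm, ← Finset.sum_add_distrib]
  refine Finset.sum_congr rfl fun ω _ => ?_
  rw [← Finset.mul_sum]
  by_cases hn : ∀ i, waitingType h e i = AgentType.H → i ∉ cycles ω
  · have h3 : ∀ i : Fin h, (Sum.inl i : Fin h ⊕ Fin e) ∉ candidates (waitingType h e) ω := by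
      intro i
      unfold candidates
      rw [if_neg (by rw [cycles_filter_nonempty_iff]; exact not_not.2 hn)]
      exact hn _ rfl
    rw [if_pos hn]
    simp [choiceProb, h3]
  · have hne := (cycles_filter_nonempty_iff (waitingType h e) ω).2 hn
    have h3 : candidates (waitingType h e) ω =
        (cycles ω).filter fun i => waitingType h e i = AgentType.H := if_pos hne
    have h4 := sum_choiceProb_some (candidates (waitingType h e) ω)
    rw [Fintype.sum_sum_type, if_neg (by rw [h3]; exact hne.ne_empty)] at h4
    have h5 : ∑ j : Fin e, choiceProb (candidates (waitingType h e) ω) (some (Sum.inr j)) = 0 := by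
      refine Finset.sum_eq_zero fun j _ => ?_
      have hj : (Sum.inr j : Fin h ⊕ Fin e) ∉ candidates (waitingType h e) ω := by
        rw [h3]
        intro hj
        cases (Finset.mem_filter.1 hj).2
      simp [choiceProb, hj]
    rw [h5, add_zero] at h4
    rw [if_neg hn, h4]
    ring

lemma matchEProb_eq (h e : ℕ) :
    matchEProb P T h e = missProb P T .H h * (1 - missProb P T .E e) := by
  have h1 := matchProb_none_add_sum P (waitingType h e) T
  rw [Fintype.sum_sum_type] at h1
  have h2 := joinProb_eq P T h e
  have h3 := matchHProb_eq P T h e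
  unfold joinProb at h2
  unfold matchHProb at h3
  unfold matchEProb
  rw [h2, h3] at h1
  linarith

/-- By symmetry, among `h + 1` waiting `H` agents a fixed one accounts for the fraction
`1 / (h + 1)` of the matches with `H` agents. -/
lemma sum_matchProb_castSucc (h e : ℕ) :
    ((h : ℝ) + 1) * ∑ i : Fin h, matchProb P (waitingType (h + 1) e) T (some (Sum.inl i.castSucc))
      = h * (1 - missProb P T .H (h + 1)) := by
  have h1 := matchHProb_eq P T (h + 1) e
  unfold matchHProb at h1
  have h2 : ∀ i : Fin (h + 1), matchProb P (waitingType (h + 1) e) T (some (Sum.inl i))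
      = matchProb P (waitingType (h + 1) e) T (some (Sum.inl (Fin.last h))) := by
    intro i
    have := matchProb_some_perm P (waitingType (h + 1) e) T
      (Equiv.sumCongr (Equiv.swap i (Fin.last h)) (Equiv.refl _))
      (by rintro (j | j) <;> rfl) (Sum.inl (Fin.last h))
    simpa using this
  simp_rw [h2] at h1 ⊢
  simp only [Finset.sum_const, Finset.card_univ, Fintype.card_fin, nsmul_eq_mul] at h1 ⊢
  rw [← h1]
  push_cast
  ring

end Totals

/-! ### The generator of the chain -/

/-- Positive arrival rates, and compatibility probabilities in `(0, 1]`. -/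
structure Params.Valid (P : Params) : Prop where
  lamH_pos : 0 < P.lamH
  lamE_pos : 0 < P.lamE
  pH_pos : 0 < P.pH
  pH_le : P.pH ≤ 1
  pE_pos : 0 < P.pE
  pE_le : P.pE ≤ 1

lemma Params.Valid.total_pos {P : Params} (hP : P.Valid) : 0 < P.total :=
  add_pos hP.lamH_pos hP.lamE_pos

lemma Params.Valid.prob_pos {P : Params} (hP : P.Valid) (T : AgentType) : 0 < P.prob T := by
  cases T
  exacts [hP.pH_pos, hP.pE_pos]

lemma Params.Valid.prob_le {P : Params} (hP : P.Valid) (T : AgentType) : P.prob T ≤ 1 := by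
  cases T
  exacts [hP.pH_le, hP.pE_le]

lemma Params.Valid.cycleProb_pos {P : Params} (hP : P.Valid) (T S : AgentType) :
    0 < P.prob T * P.prob S := mul_pos (hP.prob_pos T) (hP.prob_pos S)

lemma Params.Valid.cycleProb_le {P : Params} (hP : P.Valid) (T S : AgentType) :
    P.prob T * P.prob S ≤ 1 := mul_le_one₀ (hP.prob_le T) (hP.prob_pos S).le (hP.prob_le S)

lemma missProb_zero (P : Params) (T S : AgentType) : missProb P T S 0 = 1 := pow_zero _

lemma missProb_nonneg {P : Params} (hP : P.Valid) (T S : AgentType) (n : ℕ) :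
    0 ≤ missProb P T S n := pow_nonneg (sub_nonneg.2 (hP.cycleProb_le T S)) n

lemma missProb_le_one {P : Params} (hP : P.Valid) (T S : AgentType) (n : ℕ) :
    missProb P T S n ≤ 1 :=
  pow_le_one₀ (sub_nonneg.2 (hP.cycleProb_le T S)) (by linarith [hP.cycleProb_pos T S])

lemma missProb_lt_one {P : Params} (hP : P.Valid) (T S : AgentType) {n : ℕ} (hn : n ≠ 0) :
    missProb P T S n < 1 :=
  pow_lt_one₀ (sub_nonneg.2 (hP.cycleProb_le T S)) (by linarith [hP.cycleProb_pos T S]) hn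

/-- Bernoulli's inequality: the union bound for the probability of a match. -/
lemma one_sub_missProb_le {P : Params} (hP : P.Valid) (T S : AgentType) (n : ℕ) :
    1 - missProb P T S n ≤ n * (P.prob T * P.prob S) := by
  have := one_add_mul_le_pow (a := -(P.prob T * P.prob S))
    (by linarith [hP.cycleProb_le T S]) n
  unfold missProb
  rw [sub_eq_add_neg 1 (P.prob T * P.prob S)]
  linarith

/-- Rate at which the number of waiting `H` agents increases. -/
noncomputable def joinRateH (P : Params) (x : ℕ × ℕ) : ℝ :=
  P.lamH * (missProb P .H .H x.1 * missProb P .H .E x.2)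

/-- Rate at which the number of waiting `E` agents increases. -/
noncomputable def joinRateE (P : Params) (x : ℕ × ℕ) : ℝ :=
  P.lamE * (missProb P .E .H x.1 * missProb P .E .E x.2)

/-- Rate at which the number of waiting `H` agents decreases. -/
noncomputable def leaveRateH (P : Params) (x : ℕ × ℕ) : ℝ :=
  P.lamH * (1 - missProb P .H .H x.1) + P.lamE * (1 - missProb P .E .H x.1)

/-- Rate at which the number of waiting `E` agents decreases. -/
noncomputable def leaveRateE (P : Params) (x : ℕ × ℕ) : ℝ :=
  P.lamH * (missProb P .H .H x.1 * (1 - missProb P .H .E x.2))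
    + P.lamE * (missProb P .E .H x.1 * (1 - missProb P .E .E x.2))

lemma rates_sum (P : Params) (x : ℕ × ℕ) :
    joinRateH P x + joinRateE P x + leaveRateH P x + leaveRateE P x = P.total := by
  unfold joinRateH joinRateE leaveRateH leaveRateE Params.total
  ring

lemma joinRateH_nonneg {P : Params} (hP : P.Valid) (x : ℕ × ℕ) : 0 ≤ joinRateH P x :=
  mul_nonneg hP.lamH_pos.le (mul_nonneg (missProb_nonneg hP ..) (missProb_nonneg hP ..))

lemma joinRateE_nonneg {P : Params} (hP : P.Valid) (x : ℕ × ℕ) : 0 ≤ joinRateE P x :=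
  mul_nonneg hP.lamE_pos.le (mul_nonneg (missProb_nonneg hP ..) (missProb_nonneg hP ..))

lemma leaveRateH_nonneg {P : Params} (hP : P.Valid) (x : ℕ × ℕ) : 0 ≤ leaveRateH P x :=
  add_nonneg (mul_nonneg hP.lamH_pos.le (sub_nonneg.2 (missProb_le_one hP ..)))
    (mul_nonneg hP.lamE_pos.le (sub_nonneg.2 (missProb_le_one hP ..)))

lemma leaveRateE_nonneg {P : Params} (hP : P.Valid) (x : ℕ × ℕ) : 0 ≤ leaveRateE P x :=
  add_nonneg
    (mul_nonneg hP.lamH_pos.le (mul_nonneg (missProb_nonneg hP ..)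
      (sub_nonneg.2 (missProb_le_one hP ..))))
    (mul_nonneg hP.lamE_pos.le (mul_nonneg (missProb_nonneg hP ..)
      (sub_nonneg.2 (missProb_le_one hP ..))))

lemma leaveRateH_zero (P : Params) (e : ℕ) : leaveRateH P (0, e) = 0 := by
  simp [leaveRateH, missProb_zero]

lemma leaveRateE_zero (P : Params) (h : ℕ) : leaveRateE P (h, 0) = 0 := by
  simp [leaveRateE, missProb_zero]

/-- The expected value of `f` after the next jump, multiplied by the total rate. In an empty queue
the truncated predecessors `x.1 - 1`, `x.2 - 1` are harmless, since the rate vanishes there. -/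
noncomputable def jumpMean (P : Params) (f : ℕ × ℕ → ℝ) (x : ℕ × ℕ) : ℝ :=
  joinRateH P x * f (x.1 + 1, x.2) + joinRateE P x * f (x.1, x.2 + 1)
    + leaveRateH P x * f (x.1 - 1, x.2) + leaveRateE P x * f (x.1, x.2 - 1)

/-- The generator `f ↦ ∑ y, q(·, y) (f y - f ·)` of the chain. -/
noncomputable def gen (P : Params) (f : ℕ × ℕ → ℝ) (x : ℕ × ℕ) : ℝ :=
  jumpMean P f x - P.total * f x

lemma gen_eq (P : Params) (f : ℕ × ℕ → ℝ) (x : ℕ × ℕ) :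
    gen P f x = joinRateH P x * (f (x.1 + 1, x.2) - f x) + joinRateE P x * (f (x.1, x.2 + 1) - f x)
      + leaveRateH P x * (f (x.1 - 1, x.2) - f x) + leaveRateE P x * (f (x.1, x.2 - 1) - f x) := by
  rw [gen, jumpMean, ← rates_sum P x]
  ring

lemma transitionRate_eq (P : Params) (x y : ℕ × ℕ) :
    transitionRate P x y =
      (if y = (x.1 + 1, x.2) then joinRateH P x else 0)
      + (if y = (x.1, x.2 + 1) then joinRateE P x else 0)
      + (if y = (x.1 - 1, x.2) then leaveRateH P x else 0)
      + (if y = (x.1, x.2 - 1) then leaveRateE P x else 0) := by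
  obtain ⟨h, e⟩ := x
  obtain ⟨h', e'⟩ := y
  have hjH : P.lam .H * joinProb P .H h e = joinRateH P (h, e) := by
    rw [joinProb_eq]; rfl
  have hjE : P.lam .E * joinProb P .E h e = joinRateE P (h, e) := by
    rw [joinProb_eq]; rfl
  have hlH : P.lam .H * matchHProb P .H h e + P.lam .E * matchHProb P .E h e
      = leaveRateH P (h, e) := by
    rw [matchHProb_eq, matchHProb_eq]; rfl
  have hlE : P.lam .H * matchEProb P .H h e + P.lam .E * matchEProb P .E h e
      = leaveRateE P (h, e) := by
    rw [matchEProb_eq, matchEProb_eq]; rfl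
  unfold transitionRate
  simp only [hjH, hjE, hlH, hlE, Prod.mk.injEq]
  have hH : h = 0 → leaveRateH P (h, e) = 0 := by rintro rfl; exact leaveRateH_zero P e
  have hE : e = 0 → leaveRateE P (h, e) = 0 := by rintro rfl; exact leaveRateE_zero P h
  by_cases h1 : h' = h + 1 ∧ e' = e
  · rw [if_pos h1, if_pos h1, if_neg (by omega), if_neg (by omega), if_neg (by omega)]
    ring
  by_cases h2 : h' = h ∧ e' = e + 1
  · rw [if_neg h1, if_pos h2, if_neg h1, if_pos h2, if_neg (by omega), if_neg (by omega)]
    ring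
  rw [if_neg h1, if_neg h2, if_neg h1, if_neg h2]
  by_cases h3 : h = h' + 1 ∧ e = e'
  · rw [if_pos h3, if_pos (by omega)]
    split_ifs
    · rw [hE (by omega)]; ring
    · ring
  by_cases h4 : h = h' ∧ e = e' + 1
  · rw [if_neg h3, if_pos h4, if_pos (c := h' = h ∧ e' = e - 1) (by omega)]
    split_ifs
    · rw [hH (by omega)]; ring
    · ring
  rw [if_neg h3, if_neg h4]
  split_ifs
  · rw [hH (by omega), hE (by omega)]; ring
  · rw [hH (by omega)]; ring
  · rw [hE (by omega)]; ring
  · ring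

lemma transitionRate_nonneg {P : Params} (hP : P.Valid) (x y : ℕ × ℕ) :
    0 ≤ transitionRate P x y := by
  have h1 := joinRateH_nonneg hP x
  have h2 := joinRateE_nonneg hP x
  have h3 := leaveRateH_nonneg hP x
  have h4 := leaveRateE_nonneg hP x
  rw [transitionRate_eq]
  positivity

lemma hasSum_transitionRate_mul (P : Params) (f : ℕ × ℕ → ℝ) (x : ℕ × ℕ) :
    HasSum (fun y => transitionRate P x y * f y) (jumpMean P f x) := by
  have key : ∀ (a : ℝ) (z : ℕ × ℕ), HasSum (fun y => (if y = z then a else 0) * f y) (a * f z) := by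
    intro a z
    have := hasSum_single (f := fun y => (if y = z then a else 0) * f y) z
      (fun y hy => by simp [hy])
    simpa using this
  have := (((key (joinRateH P x) (x.1 + 1, x.2)).add (key (joinRateE P x) (x.1, x.2 + 1))).add
    (key (leaveRateH P x) (x.1 - 1, x.2))).add (key (leaveRateE P x) (x.1, x.2 - 1))
  refine this.congr_fun ?_
  intro y
  rw [transitionRate_eq]
  ring

lemma hasSum_transitionRate (P : Params) (x : ℕ × ℕ) :
    HasSum (fun y => transitionRate P x y) P.total := by
  have := hasSum_transitionRate_mul P (fun _ => 1) x
  simpa [jumpMean, rates_sum] using this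

/-- The mean drift of an integrable nonnegative test function vanishes in steady state. -/
lemma IsSteadyState.hasSum_gen {P : Params} (hP : P.Valid) {π : ℕ × ℕ → ℝ}
    (hπ : IsSteadyState P π) {f : ℕ × ℕ → ℝ} (hf : ∀ x, 0 ≤ f x)
    (hs : Summable fun x => π x * f x) : HasSum (fun x => π x * gen P f x) 0 := by
  have hin : ∀ y, HasSum (fun x => π x * transitionRate P x y * f y) (P.total * (π y * f y)) := by
    intro y
    have := (hπ.balance y).mul_right (f y)
    rw [(hasSum_transitionRate P y).tsum_eq] at this
    rwa [show P.total * (π y * f y) = π y * P.total * f y by ring]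
  have hout : ∀ x, HasSum (fun y => π x * transitionRate P x y * f y) (π x * jumpMean P f x) := by
    intro x
    refine ((hasSum_transitionRate_mul P f x).mul_left (π x)).congr_fun fun y => ?_
    ring
  have hsum : Summable fun z : (ℕ × ℕ) × (ℕ × ℕ) => π z.2 * transitionRate P z.2 z.1 * f z.1 := by
    refine (summable_prod_of_nonneg fun z => ?_).2 ⟨fun y => (hin y).summable, ?_⟩
    · exact mul_nonneg (mul_nonneg (hπ.nonneg _) (transitionRate_nonneg hP ..)) (hf _)
    · simp_rw [(hin _).tsum_eq]
      exact hs.mul_left _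
  have h1 := hsum.hasSum.prod_fiberwise hin
  have h2 : HasSum (fun z : (ℕ × ℕ) × (ℕ × ℕ) => π z.1 * transitionRate P z.1 z.2 * f z.2)
      (∑' z : (ℕ × ℕ) × (ℕ × ℕ), π z.2 * transitionRate P z.2 z.1 * f z.1) :=
    (Equiv.prodComm (ℕ × ℕ) (ℕ × ℕ)).hasSum_iff.2 hsum.hasSum
  have h3 := (h2.prod_fiberwise hout).sub h1
  rw [sub_self] at h3
  refine h3.congr_fun fun x => ?_
  rw [gen]
  ring

/-! ### Stationary distributions of Markov chains on a discrete space -/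

section MarkovChain

open scoped ENNReal

variable {α : Type*} {K : α → α → ℝ≥0∞}

lemma eq_of_tsum_eq_of_le {a b : α → ℝ≥0∞} (hb : ∑' x, b x ≠ ∞) (hab : ∀ x, a x ≤ b x)
    (hsum : ∑' x, a x = ∑' x, b x) : a = b := by
  have h1 : ∑' x, a x + ∑' x, (b x - a x) = ∑' x, a x + 0 := by
    rw [← ENNReal.tsum_add, add_zero, hsum]
    exact tsum_congr fun x => add_tsub_cancel_of_le (hab x)
  have h2 := (ENNReal.add_right_inj (by rwa [hsum])).1 h1
  funext x
  exact le_antisymm (hab x) (tsub_eq_zero_iff_le.1 (ENNReal.tsum_eq_zero.1 h2 x))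

/-- The distribution at time `n` of the chain started from `o`, on the event that it has not
returned to `o` by then. Summation over `n` gives the expected numbers of visits during an
excursion. -/
noncomputable def excursion [DecidableEq α] (K : α → α → ℝ≥0∞) (o : α) : ℕ → α → ℝ≥0∞
  | 0 => fun y => if y = o then 1 else 0
  | n + 1 => fun y => if y = o then 0 else ∑' x, excursion K o n x * K x y

/-- A chain with a Foster-Lyapunov function `V` has finite mean return time to `o`, and the expected
numbers of visits during an excursion from `o` are proportional to a stationary distribution. -/
lemma exists_stationary_of_foster (hK : ∀ x, ∑' y, K x y = 1) (o : α) (V : α → ℝ≥0∞)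
    (hV : ∀ x, x ≠ o → 1 + ∑' y, K x y * V y ≤ V x) (hVo : ∑' y, K o y * V y ≠ ∞) :
    ∃ G : α → ℝ≥0∞, ∑' x, G x = 1 ∧ ∀ y, ∑' x, G x * K x y = G y := by
  classical
  set u := excursion K o with hu
  have hu0 : ∀ f : α → ℝ≥0∞, ∑' x, u 0 x * f x = f o := by
    intro f
    rw [tsum_eq_single o]
    · simp [hu, excursion]
    · intro b hb
      simp [hu, excursion, hb]
  have huo : ∀ n, u (n + 1) o = 0 := fun n => by simp [hu, excursion]
  have hstep : ∀ n y, u (n + 1) y ≤ ∑' x, u n x * K x y := by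
    intro n y
    simp only [hu, excursion]
    split_ifs
    · exact zero_le
    · exact le_rfl
  have hval : ∀ n, ∑' y, u (n + 1) y * V y ≤ ∑' x, u n x * ∑' y, K x y * V y := by
    intro n
    calc ∑' y, u (n + 1) y * V y ≤ ∑' y, (∑' x, u n x * K x y) * V y :=
          ENNReal.tsum_le_tsum fun y => mul_le_mul_left (hstep n y) _
      _ = ∑' y, ∑' x, u n x * (K x y * V y) := by
          simp_rw [← ENNReal.tsum_mul_right, mul_assoc]
      _ = ∑' x, u n x * ∑' y, K x y * V y := by
          rw [ENNReal.tsum_comm]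
          simp_rw [ENNReal.tsum_mul_left]
  have hdec : ∀ n, ∑' x, u (n + 1) x + ∑' x, u (n + 1 + 1) x * V x ≤ ∑' x, u (n + 1) x * V x := by
    intro n
    calc ∑' x, u (n + 1) x + ∑' x, u (n + 1 + 1) x * V x
        ≤ ∑' x, u (n + 1) x + ∑' x, u (n + 1) x * ∑' y, K x y * V y := by
          exact add_le_add_right (hval (n + 1)) _
      _ = ∑' x, u (n + 1) x * (1 + ∑' y, K x y * V y) := by
          rw [← ENNReal.tsum_add]
          simp_rw [mul_add, mul_one]
      _ ≤ ∑' x, u (n + 1) x * V x := by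
          refine ENNReal.tsum_le_tsum fun x => ?_
          by_cases hx : x = o
          · simp [hx, huo]
          · gcongr
            exact hV x hx
  have hpart : ∀ N, ∑ n ∈ Finset.range N, ∑' x, u (n + 1) x + ∑' x, u (N + 1) x * V x
      ≤ ∑' y, K o y * V y := by
    intro N
    induction N with
    | zero => simpa [hu0] using hval 0
    | succ N ih =>
      refine le_trans ?_ ih
      rw [Finset.sum_range_succ, add_assoc]
      gcongr
      exact hdec N
  set G : α → ℝ≥0∞ := fun x => ∑' n, u n x with hG
  have hGsum : ∑' x, G x = ∑' n, ∑' x, u n x := ENNReal.tsum_comm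
  have hmass0 : ∑' x, u 0 x = 1 := by simpa using hu0 fun _ => 1
  have hGfin : ∑' x, G x ≠ ∞ := by
    rw [hGsum, tsum_eq_zero_add' ENNReal.summable, hmass0]
    refine ENNReal.add_ne_top.2 ⟨ENNReal.one_ne_top, ne_top_of_le_ne_top hVo ?_⟩
    rw [ENNReal.tsum_eq_iSup_nat]
    exact iSup_le fun N => le_self_add.trans (hpart N)
  have hG0 : ∑' x, G x ≠ 0 := by
    rw [hGsum]
    refine ne_of_gt (lt_of_lt_of_le zero_lt_one (hmass0.symm.le.trans ?_))
    exact ENNReal.le_tsum (f := fun n => ∑' x, u n x) 0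
  have hGK : ∀ y, ∑' x, G x * K x y = ∑' n, ∑' x, u n x * K x y := by
    intro y
    rw [ENNReal.tsum_comm]
    simp_rw [ENNReal.tsum_mul_right]
    rfl
  have hne : ∀ y, y ≠ o → ∑' x, G x * K x y = G y := by
    intro y hy
    have h0 : u 0 y = 0 := by simp [hu, excursion, hy]
    rw [hGK, hG]
    simp only
    rw [tsum_eq_zero_add' (f := fun n => u n y) ENNReal.summable, h0, zero_add]
    refine tsum_congr fun n => ?_
    simp [hu, excursion, hy]
  -- The mass missing at `o` is recovered from the conservation of the total mass.
  have htot : ∑' y, ∑' x, G x * K x y = ∑' y, G y := by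
    rw [ENNReal.tsum_comm]
    simp_rw [ENNReal.tsum_mul_left, hK, mul_one]
  have hstat : (fun y => ∑' x, G x * K x y) = G := by
    rcases le_total (∑' x, G x * K x o) (G o) with ho | ho
    · refine eq_of_tsum_eq_of_le hGfin (fun y => ?_) htot
      by_cases hy : y = o
      · rwa [hy]
      · exact (hne y hy).le
    · refine (eq_of_tsum_eq_of_le (by rwa [htot]) (fun y => ?_) htot.symm).symm
      by_cases hy : y = o
      · rwa [hy]
      · exact (hne y hy).ge
  refine ⟨fun x => G x * (∑' x, G x)⁻¹, ?_, fun y => ?_⟩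
  · rw [ENNReal.tsum_mul_right, ENNReal.mul_inv_cancel hG0 hGfin]
  · have : ∑' x, G x * K x y = G y := congrFun hstat y
    simp_rw [mul_right_comm _ _ (K _ y)]
    rw [ENNReal.tsum_mul_right, this]

/-- If every state leads to `o`, a stationary measure vanishing at `o` vanishes. -/
lemma stationary_eq_zero {o : α} {rank : α → ℕ}
    (hr : ∀ x, x ≠ o → ∃ y, K x y ≠ 0 ∧ rank y < rank x) {d : α → ℝ≥0∞}
    (hd : ∀ y, ∑' x, d x * K x y = d y) (hdo : d o = 0) (x : α) : d x = 0 := by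
  induction hn : rank x using Nat.strong_induction_on generalizing x with
  | _ n ih =>
    by_cases hx : x = o
    · rw [hx, hdo]
    · obtain ⟨y, hy, hlt⟩ := hr x hx
      have h1 : d y = 0 := ih _ (hn ▸ hlt) y rfl
      have h2 : d x * K x y ≤ 0 := by
        rw [← h1, ← hd y]
        exact ENNReal.le_tsum (f := fun x => d x * K x y) x
      exact (mul_eq_zero.1 (le_antisymm h2 zero_le)).resolve_right hy

/-- The minimum of two stationary distributions is stationary, hence so are the remainders, which
have disjoint supports. As every state leads to `o`, one of the remainders is zero. -/
lemma stationary_unique (hK : ∀ x, ∑' y, K x y = 1) {o : α} {rank : α → ℕ}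
    (hr : ∀ x, x ≠ o → ∃ y, K x y ≠ 0 ∧ rank y < rank x) {p q : α → ℝ≥0∞}
    (hp1 : ∑' x, p x = 1) (hq1 : ∑' x, q x = 1) (hp : ∀ y, ∑' x, p x * K x y = p y)
    (hq : ∀ y, ∑' x, q x * K x y = q y) : p = q := by
  set m : α → ℝ≥0∞ := fun x => min (p x) (q x) with hm
  have hmp : ∀ x, m x ≤ p x := fun x => min_le_left ..
  have hmq : ∀ x, m x ≤ q x := fun x => min_le_right ..
  have hmK : ∀ y, ∑' x, m x * K x y ≤ m y := by
    intro y
    refine le_min ?_ ?_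
    · rw [← hp y]
      exact ENNReal.tsum_le_tsum fun x => mul_le_mul_left (hmp x) _
    · rw [← hq y]
      exact ENNReal.tsum_le_tsum fun x => mul_le_mul_left (hmq x) _
  have hmfin : ∑' x, m x ≠ ∞ :=
    ne_top_of_le_ne_top ENNReal.one_ne_top ((ENNReal.tsum_le_tsum hmp).trans hp1.le)
  have hmx : ∀ x, m x ≠ ∞ := fun x => ne_top_of_le_ne_top hmfin (ENNReal.le_tsum x)
  have hmtot : ∑' y, ∑' x, m x * K x y = ∑' y, m y := by
    rw [ENNReal.tsum_comm]
    simp_rw [ENNReal.tsum_mul_left, hK, mul_one]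
  have hmstat : ∀ y, ∑' x, m x * K x y = m y :=
    fun y => congrFun (eq_of_tsum_eq_of_le hmfin hmK hmtot) y
  have hrem : ∀ {a : α → ℝ≥0∞}, (∀ y, ∑' x, a x * K x y = a y) → (∀ x, m x ≤ a x) →
      ∀ y, ∑' x, (a x - m x) * K x y = a y - m y := by
    intro a ha hma y
    have h1 : ∑' x, (a x - m x) * K x y + m y = a y := by
      conv_lhs => rw [← hmstat y]
      rw [← ENNReal.tsum_add, ← ha y]
      refine tsum_congr fun x => ?_
      rw [← add_mul, tsub_add_cancel_of_le (hma x)]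
    rw [← h1, ENNReal.add_sub_cancel_right (hmx y)]
  rcases le_total (p o) (q o) with ho | ho
  · have hz := stationary_eq_zero hr (hrem hp hmp) (by simp [hm, ho])
    refine eq_of_tsum_eq_of_le (by simp [hq1]) (fun x => ?_) (hp1.trans hq1.symm)
    exact (tsub_eq_zero_iff_le.1 (hz x)).trans (hmq x)
  · have hz := stationary_eq_zero hr (hrem hq hmq) (by simp [hm, ho])
    refine (eq_of_tsum_eq_of_le (by simp [hp1]) (fun x => ?_) (hq1.trans hp1.symm)).symm
    exact (tsub_eq_zero_iff_le.1 (hz x)).trans (hmp x)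

end MarkovChain

/-! ### Existence, uniqueness and exponential moments of the steady state -/

lemma gen_size {P : Params} (v : ℕ → ℝ) (x : ℕ × ℕ) :
    gen P (fun y => v (y.1 + y.2)) x
      = (joinRateH P x + joinRateE P x) * (v (x.1 + x.2 + 1) - v (x.1 + x.2))
        - (P.total - (joinRateH P x + joinRateE P x)) * (v (x.1 + x.2) - v (x.1 + x.2 - 1)) := by
  obtain ⟨h, e⟩ := x
  have hH : leaveRateH P (h, e) * v (h - 1 + e) = leaveRateH P (h, e) * v (h + e - 1) := by
    rcases h with _ | h
    · simp [leaveRateH_zero]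
    · congr 2; omega
  have hE : leaveRateE P (h, e) * v (h + (e - 1)) = leaveRateE P (h, e) * v (h + e - 1) := by
    rcases e with _ | e
    · simp [leaveRateE_zero]
    · congr 2
  rw [gen_eq, ← rates_sum P (h, e)]
  simp only
  rw [show h + 1 + e = h + e + 1 by ring, ← add_assoc, mul_sub (leaveRateH P (h, e)), hH,
    mul_sub (leaveRateE P (h, e)), hE]
  ring

/-- The probability that the next newcomer joins decays geometrically in the number of waiting
agents, whatever their types. -/
lemma exists_joinRate_le {P : Params} (hP : P.Valid) : ∃ ρ : ℝ, 0 ≤ ρ ∧ ρ < 1 ∧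
    ∀ x, joinRateH P x + joinRateE P x ≤ P.total * ρ ^ (x.1 + x.2) := by
  set m := min P.pH P.pE with hm
  have hm0 : 0 < m := lt_min hP.pH_pos hP.pE_pos
  have hm1 : m ≤ 1 := (min_le_left _ _).trans hP.pH_le
  have hmiss : ∀ T S n, missProb P T S n ≤ (1 - m * m) ^ n := by
    intro T S n
    have hT : ∀ T, m ≤ P.prob T := by
      intro T
      cases T
      exacts [min_le_left _ _, min_le_right _ _]
    refine pow_le_pow_left₀ (sub_nonneg.2 (hP.cycleProb_le T S)) ?_ n
    have := mul_le_mul (hT T) (hT S) hm0.le (hP.prob_pos T).le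
    linarith
  refine ⟨1 - m * m, by nlinarith, by nlinarith, fun x => ?_⟩
  have key : ∀ T, missProb P T .H x.1 * missProb P T .E x.2 ≤ (1 - m * m) ^ (x.1 + x.2) := by
    intro T
    rw [pow_add]
    exact mul_le_mul (hmiss ..) (hmiss ..) (missProb_nonneg hP ..) (pow_nonneg (by nlinarith) _)
  unfold joinRateH joinRateE Params.total
  rw [add_mul]
  exact add_le_add (mul_le_mul_of_nonneg_left (key _) hP.lamH_pos.le)
    (mul_le_mul_of_nonneg_left (key _) hP.lamE_pos.le)

lemma gen_size_le {P : Params} {v : ℕ → ℝ} (hv : Monotone v) {x : ℕ × ℕ} {u : ℝ}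
    (hu : joinRateH P x + joinRateE P x ≤ P.total * u) :
    gen P (fun y => v (y.1 + y.2)) x ≤ P.total *
      (u * (v (x.1 + x.2 + 1) - v (x.1 + x.2))
        - (1 - u) * (v (x.1 + x.2) - v (x.1 + x.2 - 1))) := by
  rw [gen_size]
  have h1 : 0 ≤ v (x.1 + x.2 + 1) - v (x.1 + x.2) := sub_nonneg.2 (hv (Nat.le_succ _))
  have h2 : 0 ≤ v (x.1 + x.2) - v (x.1 + x.2 - 1) := sub_nonneg.2 (hv (Nat.sub_le _ _))
  have h3 := mul_le_mul_of_nonneg_right hu h1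
  have h4 := mul_le_mul_of_nonneg_right hu h2
  linarith

/-- Increments of a Foster-Lyapunov function for a birth-death chain which moves up from `n` with
probability at most `ρ ^ n`: constant increments do far out, and the remaining ones are found by
backward recursion. -/
lemma exists_foster_increments {ρ : ℝ} (h0 : 0 ≤ ρ) (h1 : ρ < 1) : ∃ Δ : ℕ → ℝ, (∀ n, 0 ≤ Δ n) ∧
    ∀ n, ρ ^ (n + 1) * Δ (n + 1) + 1 ≤ (1 - ρ ^ (n + 1)) * Δ n := by
  obtain ⟨N, hN⟩ := exists_pow_lt_of_lt_one (show (0 : ℝ) < 1 / 4 by norm_num) h1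
  have hback : ∀ M, (∃ Δ : ℕ → ℝ, (∀ n, 0 ≤ Δ n) ∧
      ∀ n, M ≤ n → ρ ^ (n + 1) * Δ (n + 1) + 1 ≤ (1 - ρ ^ (n + 1)) * Δ n) →
      ∃ Δ : ℕ → ℝ, (∀ n, 0 ≤ Δ n) ∧
        ∀ n, ρ ^ (n + 1) * Δ (n + 1) + 1 ≤ (1 - ρ ^ (n + 1)) * Δ n := by
    intro M
    induction M with
    | zero => exact fun ⟨Δ, hΔ, h⟩ => ⟨Δ, hΔ, fun n => h n n.zero_le⟩
    | succ M ih =>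
      rintro ⟨Δ, hΔ, h⟩
      apply ih
      have hpos : 0 < 1 - ρ ^ (M + 1) := sub_pos.2 (pow_lt_one₀ h0 h1 M.succ_ne_zero)
      have hnum : 0 ≤ ρ ^ (M + 1) * Δ (M + 1) + 1 :=
        add_nonneg (mul_nonneg (pow_nonneg h0 _) (hΔ _)) zero_le_one
      refine ⟨Function.update Δ M ((ρ ^ (M + 1) * Δ (M + 1) + 1) / (1 - ρ ^ (M + 1))),
        fun n => ?_, fun n hn => ?_⟩
      · by_cases hn : n = M
        · subst hn
          rw [Function.update_self]
          exact div_nonneg hnum hpos.le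
        · rw [Function.update_of_ne hn]
          exact hΔ n
      · rw [Function.update_of_ne (show n + 1 ≠ M by omega)]
        rcases hn.eq_or_lt with rfl | hlt
        · rw [Function.update_self, mul_div_cancel₀ _ hpos.ne']
        · rw [Function.update_of_ne hlt.ne']
          exact h n hlt
  refine hback N ⟨fun _ => 2, fun _ => by norm_num, fun n hn => ?_⟩
  have : ρ ^ (n + 1) ≤ ρ ^ N := pow_le_pow_of_le_one h0 h1.le (by omega)
  linarith

/-- A Foster-Lyapunov function depending only on the number of waiting agents. -/
lemma exists_foster {P : Params} (hP : P.Valid) : ∃ v : ℕ → ℝ, (∀ n, 0 ≤ v n) ∧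
    ∀ x : ℕ × ℕ, x ≠ (0, 0) →
      jumpMean P (fun y => v (y.1 + y.2)) x + P.total ≤ P.total * v (x.1 + x.2) := by
  obtain ⟨ρ, h0, h1, hρ⟩ := exists_joinRate_le hP
  obtain ⟨Δ, hΔ, h⟩ := exists_foster_increments h0 h1
  refine ⟨fun n => ∑ k ∈ Finset.range n, Δ k, fun n => Finset.sum_nonneg fun k _ => hΔ k,
    fun x hx => ?_⟩
  have hmono : Monotone fun n => ∑ k ∈ Finset.range n, Δ k :=
    monotone_nat_of_le_succ fun n => by
      rw [Finset.sum_range_succ]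
      exact le_add_of_nonneg_right (hΔ n)
  have hg := gen_size_le hmono (hρ x)
  obtain ⟨n, hn⟩ : ∃ n, x.1 + x.2 = n + 1 := by
    refine Nat.exists_eq_succ_of_ne_zero fun h => hx ?_
    ext <;> simp <;> omega
  rw [hn] at hg ⊢
  rw [gen] at hg
  simp only [hn] at hg
  simp only [Nat.add_sub_cancel, Finset.sum_range_succ, add_sub_cancel_left] at hg ⊢
  have h2 := mul_le_mul_of_nonneg_left (h n) hP.total_pos.le
  linarith

/-- The embedded jump chain, as a Markov kernel. -/
noncomputable def jumpKernel (P : Params) (x y : ℕ × ℕ) : ENNReal :=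
  ENNReal.ofReal (transitionRate P x y / P.total)

lemma tsum_jumpKernel_mul {P : Params} (hP : P.Valid) {f : ℕ × ℕ → ℝ} (hf : ∀ x, 0 ≤ f x)
    (x : ℕ × ℕ) : ∑' y, jumpKernel P x y * ENNReal.ofReal (f y)
      = ENNReal.ofReal (jumpMean P f x / P.total) := by
  have h1 := (hasSum_transitionRate_mul P f x).div_const P.total
  have hq : ∀ y, 0 ≤ transitionRate P x y / P.total :=
    fun y => div_nonneg (transitionRate_nonneg hP x y) hP.total_pos.le
  rw [← h1.tsum_eq, ENNReal.ofReal_tsum_of_nonneg _ h1.summable]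
  · refine tsum_congr fun y => ?_
    rw [jumpKernel, ← ENNReal.ofReal_mul (hq y)]
    congr 1
    ring
  · intro y
    rw [mul_div_right_comm]
    exact mul_nonneg (hq y) (hf y)

lemma tsum_jumpKernel {P : Params} (hP : P.Valid) (x : ℕ × ℕ) : ∑' y, jumpKernel P x y = 1 := by
  have h := tsum_jumpKernel_mul hP (f := fun _ => 1) (fun _ => zero_le_one) x
  have h1 : jumpMean P (fun _ => 1) x = P.total := by simp [jumpMean, rates_sum]
  rw [h1, div_self hP.total_pos.ne'] at h
  simpa using h

/-- In a nonempty market the next newcomer is matched with positive probability. -/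
lemma exists_jumpKernel_ne_zero {P : Params} (hP : P.Valid) (x : ℕ × ℕ) (hx : x ≠ (0, 0)) :
    ∃ y, jumpKernel P x y ≠ 0 ∧ y.1 + y.2 < x.1 + x.2 := by
  obtain ⟨h, e⟩ := x
  have hpos : ∀ y, 0 < transitionRate P (h, e) y → jumpKernel P (h, e) y ≠ 0 := fun y hy =>
    (ENNReal.ofReal_pos.2 (div_pos hy hP.total_pos)).ne'
  have h1 := joinRateH_nonneg hP (h, e)
  have h2 := joinRateE_nonneg hP (h, e)
  have h3 := leaveRateH_nonneg hP (h, e)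
  have h4 := leaveRateE_nonneg hP (h, e)
  rcases h with _ | h
  · rcases e with _ | e
    · exact absurd rfl hx
    · refine ⟨(0, e), hpos _ ?_, by simp⟩
      have hlt : 0 < leaveRateE P (0, e + 1) := by
        have := missProb_lt_one hP .H .E e.succ_ne_zero
        have := missProb_lt_one hP .E .E e.succ_ne_zero
        simp only [leaveRateE, missProb_zero, one_mul]
        exact add_pos (mul_pos hP.lamH_pos (by linarith)) (mul_pos hP.lamE_pos (by linarith))
      rw [transitionRate_eq]
      simp only [Nat.add_sub_cancel, if_true]
      exact add_pos_of_nonneg_of_pos (by positivity) hlt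
  · refine ⟨(h, e), hpos _ ?_, by simp only; omega⟩
    have hlt : 0 < leaveRateH P (h + 1, e) := by
      have := missProb_lt_one hP .H .H h.succ_ne_zero
      have := missProb_lt_one hP .E .H h.succ_ne_zero
      exact add_pos (mul_pos hP.lamH_pos (by linarith)) (mul_pos hP.lamE_pos (by linarith))
    rw [transitionRate_eq]
    simp only [Nat.add_sub_cancel, if_true]
    exact add_pos_of_pos_of_nonneg (add_pos_of_nonneg_of_pos (by positivity) hlt) (by positivity)

lemma isSteadyState_toReal {P : Params} (hP : P.Valid) {G : ℕ × ℕ → ENNReal}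
    (hG1 : ∑' x, G x = 1) (hG : ∀ y, ∑' x, G x * jumpKernel P x y = G y) :
    IsSteadyState P fun x => (G x).toReal := by
  refine ⟨fun x => ENNReal.toReal_nonneg, ?_, fun y => ?_⟩
  · have := ENNReal.hasSum_toReal (f := G) (by simp [hG1])
    rwa [← ENNReal.tsum_toReal_eq, hG1, ENNReal.toReal_one] at this
    intro x
    exact ENNReal.ne_top_of_tsum_ne_top (by simp [hG1]) x
  · have hfin : G y ≠ ⊤ := ENNReal.ne_top_of_tsum_ne_top (by simp [hG1]) y
    have hs : ∑' x, G x * jumpKernel P x y ≠ ⊤ := by rwa [hG y]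
    have := (ENNReal.hasSum_toReal hs).mul_right P.total
    rw [← ENNReal.tsum_toReal_eq fun x => ENNReal.ne_top_of_tsum_ne_top hs x, hG y] at this
    rw [(hasSum_transitionRate P y).tsum_eq]
    refine this.congr_fun fun x => ?_
    rw [ENNReal.toReal_mul, jumpKernel, ENNReal.toReal_ofReal
      (div_nonneg (transitionRate_nonneg hP ..) hP.total_pos.le), mul_assoc,
      div_mul_cancel₀ _ hP.total_pos.ne']

lemma IsSteadyState.tsum_ofReal {P : Params} {π : ℕ × ℕ → ℝ} (hπ : IsSteadyState P π) :
    ∑' x, ENNReal.ofReal (π x) = 1 := by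
  rw [← ENNReal.ofReal_tsum_of_nonneg hπ.nonneg hπ.sum_one.summable, hπ.sum_one.tsum_eq,
    ENNReal.ofReal_one]

lemma IsSteadyState.tsum_ofReal_mul {P : Params} (hP : P.Valid) {π : ℕ × ℕ → ℝ}
    (hπ : IsSteadyState P π) (y : ℕ × ℕ) :
    ∑' x, ENNReal.ofReal (π x) * jumpKernel P x y = ENNReal.ofReal (π y) := by
  have h := (hπ.balance y).div_const P.total
  rw [(hasSum_transitionRate P y).tsum_eq, mul_div_cancel_right₀ _ hP.total_pos.ne'] at h
  rw [← h.tsum_eq, ENNReal.ofReal_tsum_of_nonneg _ h.summable]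
  · refine tsum_congr fun x => ?_
    rw [jumpKernel, ← ENNReal.ofReal_mul (hπ.nonneg x), mul_div_assoc]
  · exact fun x => div_nonneg (mul_nonneg (hπ.nonneg x) (transitionRate_nonneg hP ..))
      hP.total_pos.le

lemma existsUnique_isSteadyState {P : Params} (hP : P.Valid) : ∃! π, IsSteadyState P π := by
  obtain ⟨v, hv0, hv⟩ := exists_foster hP
  have hV := tsum_jumpKernel_mul hP (f := fun y => v (y.1 + y.2)) fun _ => hv0 _
  obtain ⟨G, hG1, hG⟩ := exists_stationary_of_foster (tsum_jumpKernel hP) (0, 0)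
    (fun y => ENNReal.ofReal (v (y.1 + y.2))) (fun x hx => by
      have hj : 0 ≤ jumpMean P (fun y => v (y.1 + y.2)) x := by
        refine add_nonneg (add_nonneg (add_nonneg ?_ ?_) ?_) ?_
        exacts [mul_nonneg (joinRateH_nonneg hP x) (hv0 _),
          mul_nonneg (joinRateE_nonneg hP x) (hv0 _), mul_nonneg (leaveRateH_nonneg hP x) (hv0 _),
          mul_nonneg (leaveRateE_nonneg hP x) (hv0 _)]
      rw [hV x, ← ENNReal.ofReal_one,
        ← ENNReal.ofReal_add zero_le_one (div_nonneg hj hP.total_pos.le)]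
      refine ENNReal.ofReal_le_ofReal ?_
      rw [← sub_nonneg]
      have h1 : v (x.1 + x.2) - (1 + jumpMean P (fun y => v (y.1 + y.2)) x / P.total)
          = (P.total * v (x.1 + x.2) - (jumpMean P (fun y => v (y.1 + y.2)) x + P.total))
            / P.total := by
        field_simp [hP.total_pos.ne']
        ring
      rw [h1]
      exact div_nonneg (sub_nonneg.2 (hv x hx)) hP.total_pos.le)
    (by rw [hV]; exact ENNReal.ofReal_ne_top)
  refine ⟨_, isSteadyState_toReal hP hG1 hG, fun π hπ => ?_⟩
  have h := stationary_unique (rank := fun x => x.1 + x.2) (tsum_jumpKernel hP)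
    (exists_jumpKernel_ne_zero hP) hπ.tsum_ofReal hG1 (hπ.tsum_ofReal_mul hP) hG
  funext x
  rw [← congrFun h x, ENNReal.toReal_ofReal (hπ.nonneg x)]

section Moments

variable {P : Params} {π : ℕ × ℕ → ℝ}

lemma IsSteadyState.summable_mul_of_le (hπ : IsSteadyState P π) {f : ℕ × ℕ → ℝ} {c : ℝ}
    (hf : ∀ x, |f x| ≤ c) : Summable fun x => π x * f x := by
  refine Summable.of_norm_bounded (hπ.sum_one.summable.mul_right c) fun x => ?_
  rw [Real.norm_eq_abs, abs_mul, abs_of_nonneg (hπ.nonneg x)]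
  exact mul_le_mul_of_nonneg_left (hf x) (hπ.nonneg x)

/-- The number of waiting agents has an exponential moment: compare with the drift of
`2 ^ min n k`, where `n` is the number of waiting agents, and let `k` tend to infinity. -/
lemma IsSteadyState.summable_two_pow (hP : P.Valid) (hπ : IsSteadyState P π) :
    Summable fun x => π x * 2 ^ (x.1 + x.2) := by
  obtain ⟨ρ, h0, h1, hρ⟩ := exists_joinRate_le hP
  obtain ⟨N, hN⟩ := exists_pow_lt_of_lt_one (show (0 : ℝ) < 1 / 6 by norm_num) h1
  have hdrift : ∀ k (x : ℕ × ℕ), gen P (fun y => 2 ^ (min (y.1 + y.2) k)) x ≤ P.total *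
      (2 * 2 ^ N - if x.1 + x.2 < k then 2 ^ (x.1 + x.2) / 4 else 0) := by
    intro k x
    have hmono : Monotone fun n : ℕ => (2 : ℝ) ^ (min n k) := fun a b hab =>
      pow_le_pow_right₀ one_le_two (min_le_min_right k hab)
    refine (gen_size_le hmono (hρ x)).trans (mul_le_mul_of_nonneg_left ?_ hP.total_pos.le)
    generalize x.1 + x.2 = n
    have hu1 : ρ ^ n ≤ 1 := pow_le_one₀ h0 h1.le
    have hu0 : 0 ≤ ρ ^ n := pow_nonneg h0 n
    have h2N : (0 : ℝ) < 2 ^ N := by positivity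
    have hdec : 0 ≤ (2 : ℝ) ^ min n k - 2 ^ min (n - 1) k := sub_nonneg.2 (hmono (Nat.sub_le n 1))
    split_ifs with hk
    · have h2n : (0 : ℝ) < 2 ^ n := by positivity
      rw [min_eq_left (show n + 1 ≤ k from hk), min_eq_left hk.le, pow_succ]
      rw [min_eq_left hk.le] at hdec
      by_cases hn : N < n
      · obtain ⟨m, rfl⟩ := Nat.exists_eq_succ_of_ne_zero (show n ≠ 0 by omega)
        have hu : ρ ^ (m + 1) ≤ ρ ^ N := pow_le_pow_of_le_one h0 h1.le (by omega)
        rw [Nat.succ_sub_one, min_eq_left (show m ≤ k by omega)]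
        simp only [Nat.succ_eq_add_one, pow_succ (2 : ℝ)] at *
        nlinarith
      · have hle : (2 : ℝ) ^ n ≤ 2 ^ N := pow_le_pow_right₀ one_le_two (by omega)
        nlinarith
    · rw [min_eq_right (show k ≤ n + 1 by omega), min_eq_right (show k ≤ n by omega)]
      rw [min_eq_right (show k ≤ n by omega)] at hdec
      nlinarith
  have hs2 : ∀ k, Summable fun x =>
      π x * (if x.1 + x.2 < k then (2 : ℝ) ^ (x.1 + x.2) / 4 else 0) := fun k =>
    hπ.summable_mul_of_le (c := 2 ^ k) fun x => by
      split_ifs with hk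
      · rw [abs_of_nonneg (by positivity)]
        have : (2 : ℝ) ^ (x.1 + x.2) ≤ 2 ^ k := pow_le_pow_right₀ one_le_two hk.le
        linarith [show (0 : ℝ) < 2 ^ (x.1 + x.2) by positivity]
      · simp
  have hbound : ∀ k, ∑' x, π x * (if x.1 + x.2 < k then (2 : ℝ) ^ (x.1 + x.2) / 4 else 0)
      ≤ 2 * 2 ^ N := by
    intro k
    have hs := hπ.summable_mul_of_le (f := fun y => (2 : ℝ) ^ (min (y.1 + y.2) k)) (c := 2 ^ k)
      (fun x => by
        rw [abs_of_nonneg (by positivity)]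
        exact pow_le_pow_right₀ one_le_two (min_le_right _ _))
    have hz := hπ.hasSum_gen hP (fun x => by positivity) hs
    have hle := hasSum_le (fun x => mul_le_mul_of_nonneg_left (hdrift k x) (hπ.nonneg x)) hz
      (((hπ.sum_one.mul_right (2 * 2 ^ N)).sub (hs2 k).hasSum).mul_left P.total |>.congr_fun
        fun x => by ring)
    have := nonneg_of_mul_nonneg_right hle hP.total_pos
    linarith
  refine summable_of_sum_le (c := 4 * (2 * 2 ^ N))
    (fun x => mul_nonneg (hπ.nonneg x) (by positivity)) fun s => ?_
  set k := s.sup (fun x => x.1 + x.2) + 1 with hk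
  have h2 := ((hs2 k).sum_le_tsum s fun x _ =>
    mul_nonneg (hπ.nonneg x) (by split_ifs <;> positivity)).trans (hbound k)
  calc ∑ x ∈ s, π x * 2 ^ (x.1 + x.2)
      = 4 * ∑ x ∈ s, π x * (if x.1 + x.2 < k then (2 : ℝ) ^ (x.1 + x.2) / 4 else 0) := by
        rw [Finset.mul_sum]
        refine Finset.sum_congr rfl fun x hx => ?_
        rw [if_pos (Nat.lt_succ_of_le (Finset.le_sup (f := fun x => x.1 + x.2) hx))]
        ring
    _ ≤ 4 * (2 * 2 ^ N) := by gcongr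

lemma IsSteadyState.summable_mul_of_le_sq (hP : P.Valid) (hπ : IsSteadyState P π)
    {f : ℕ × ℕ → ℝ} {c : ℝ} (hf : ∀ x, |f x| ≤ c * ((x.1 + x.2 : ℕ) + 1) ^ 2) :
    Summable fun x => π x * f x := by
  have hsq : ∀ n : ℕ, ((n : ℝ) + 1) ^ 2 ≤ 4 * 2 ^ n := by
    intro n
    have h : ((n : ℝ) + 1) ^ 2 ≤ 3 * 2 ^ n ∨ n ≤ 3 := by
      rcases le_or_gt n 3 with h | h
      · exact Or.inr h
      · left
        induction n, h using Nat.le_induction with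
        | base => norm_num
        | succ n hn ih =>
          have : (4 : ℝ) ≤ n := by exact_mod_cast hn
          rw [pow_succ (2 : ℝ)]
          push_cast
          nlinarith
    rcases h with h | h
    · linarith [show (0 : ℝ) < 2 ^ n by positivity]
    · interval_cases n <;> norm_num
  have hc : 0 ≤ c := by
    have := (abs_nonneg _).trans (hf (0, 0))
    simpa using this
  refine Summable.of_norm_bounded ((hπ.summable_two_pow hP).mul_left (c * 4)) fun x => ?_
  rw [Real.norm_eq_abs, abs_mul, abs_of_nonneg (hπ.nonneg x)]
  calc π x * |f x| ≤ π x * (c * (4 * 2 ^ (x.1 + x.2))) := by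
        refine mul_le_mul_of_nonneg_left ((hf x).trans ?_) (hπ.nonneg x)
        exact mul_le_mul_of_nonneg_left (hsq _) hc
    _ = c * 4 * (π x * 2 ^ (x.1 + x.2)) := by ring

end Moments

/-! ### Little's law -/

/-- One arrival seen by the tagged agent, after multiplication by the number of waiting `H` agents:
each of them may be the tagged one. -/
lemma mul_taggedStep {P : Params} (hP : P.Valid) (f : ℕ → ℕ → ℝ) (h e : ℕ) :
    P.total * ((h + 1) * taggedStep P f h e)
      = joinRateH P (h + 1, e) * ((h + 1) * f (h + 1) e)
        + joinRateE P (h + 1, e) * ((h + 1) * f h (e + 1))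
        + leaveRateH P (h + 1, e) * (h * f (h - 1) e)
        + leaveRateE P (h + 1, e) * ((h + 1) * f h (e - 1)) := by
  have hT := hP.total_pos.ne'
  have h1 := sum_matchProb_castSucc P .H h e
  have h2 := sum_matchProb_castSucc P .E h e
  unfold taggedStep taggedStep.matchOther
  rw [joinProb_eq, joinProb_eq, matchEProb_eq, matchEProb_eq]
  generalize (∑ i : Fin h, matchProb P (waitingType (h + 1) e) .H (some (Sum.inl i.castSucc))) = s
    at h1 ⊢
  generalize (∑ i : Fin h, matchProb P (waitingType (h + 1) e) .E (some (Sum.inl i.castSucc))) = t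
    at h2 ⊢
  unfold joinRateH joinRateE leaveRateH leaveRateE
  simp only [Params.lam]
  have e1 : ∀ u w : ℝ, P.total * ((h + 1) * (P.lamH / P.total * u + P.lamE / P.total * w))
      = P.lamH * ((h + 1) * u) + P.lamE * ((h + 1) * w) := by
    intro u w
    field_simp
  rw [e1]
  linear_combination (P.lamH * f (h - 1) e) * h1 + (P.lamE * f (h - 1) e) * h2

lemma stayProb_nonneg {P : Params} (hP : P.Valid) (n h e : ℕ) : 0 ≤ stayProb P n h e := by
  induction n generalizing h e with
  | zero => exact zero_le_one
  | succ n ih =>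
    have h1 := mul_taggedStep hP (stayProb P n) h e
    have h2 : 0 ≤ P.total * (((h : ℝ) + 1) * taggedStep P (stayProb P n) h e) := by
      rw [h1]
      refine add_nonneg (add_nonneg (add_nonneg ?_ ?_) ?_) ?_
      exacts [mul_nonneg (joinRateH_nonneg hP _) (mul_nonneg (by positivity) (ih _ _)),
        mul_nonneg (joinRateE_nonneg hP _) (mul_nonneg (by positivity) (ih _ _)),
        mul_nonneg (leaveRateH_nonneg hP _) (mul_nonneg (by positivity) (ih _ _)),
        mul_nonneg (leaveRateE_nonneg hP _) (mul_nonneg (by positivity) (ih _ _))]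
    exact nonneg_of_mul_nonneg_right (nonneg_of_mul_nonneg_right h2 hP.total_pos) (by positivity)

/-- A function of the tagged agent's surroundings is dominated after one arrival by the jump chain
which counts the tagged agent among the waiting ones. -/
lemma taggedStep_le {P : Params} (hP : P.Valid) {f : ℕ → ℕ → ℝ} {g : ℕ × ℕ → ℝ}
    (hg : ∀ x, 0 ≤ g x) (hfg : ∀ h e, f h e ≤ g (h + 1, e)) (h e : ℕ) :
    P.total * taggedStep P f h e ≤ jumpMean P g (h + 1, e) := by
  have hh : (0 : ℝ) < h + 1 := by positivity
  have h3 := leaveRateH_nonneg hP (h + 1, e)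
  refine le_of_mul_le_mul_left ?_ hh
  have h1 := mul_taggedStep hP f h e
  rw [show ((h : ℝ) + 1) * (P.total * taggedStep P f h e)
    = P.total * ((h + 1) * taggedStep P f h e) by ring, h1, jumpMean, mul_add, mul_add, mul_add]
  refine add_le_add (add_le_add (add_le_add ?_ ?_) ?_) ?_
  · rw [mul_left_comm]
    exact mul_le_mul_of_nonneg_left (mul_le_mul_of_nonneg_left (hfg _ _) (joinRateH_nonneg hP _))
      hh.le
  · rw [mul_left_comm]
    exact mul_le_mul_of_nonneg_left (mul_le_mul_of_nonneg_left (hfg _ _) (joinRateE_nonneg hP _))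
      hh.le
  · rw [mul_left_comm ((h : ℝ) + 1)]
    refine mul_le_mul_of_nonneg_left ?_ h3
    rcases h with _ | h
    · simpa using hg _
    · simp only [Nat.add_sub_cancel]
      exact (mul_le_mul_of_nonneg_left (hfg h e) (by positivity)).trans
        (mul_le_mul_of_nonneg_right (by linarith) (hg _))
  · rw [mul_left_comm]
    exact mul_le_mul_of_nonneg_left (mul_le_mul_of_nonneg_left (hfg _ _) (leaveRateE_nonneg hP _))
      hh.le

lemma stayProb_le_one {P : Params} (hP : P.Valid) (n h e : ℕ) : stayProb P n h e ≤ 1 := by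
  induction n generalizing h e with
  | zero => exact le_rfl
  | succ n ih =>
    have h1 := taggedStep_le hP (g := fun _ => 1) (fun _ => zero_le_one) ih h e
    rw [show jumpMean P (fun _ => 1) (h + 1, e) = P.total * 1 by simp [jumpMean, rates_sum]] at h1
    exact le_of_mul_le_mul_left h1 hP.total_pos

lemma taggedStep_sum {P : Params} (hP : P.Valid) (f : ℕ → ℕ → ℕ → ℝ) (N h e : ℕ) :
    taggedStep P (fun h e => ∑ n ∈ Finset.range N, f n h e) h e
      = ∑ n ∈ Finset.range N, taggedStep P (f n) h e := by
  have hne : P.total * ((h : ℝ) + 1) ≠ 0 := mul_ne_zero hP.total_pos.ne' (by positivity)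
  refine mul_left_cancel₀ hne ?_
  rw [Finset.mul_sum,
    Finset.sum_congr rfl fun n _ => (mul_assoc _ _ _).trans (mul_taggedStep hP (f n) h e),
    mul_assoc, mul_taggedStep hP]
  simp only [Finset.mul_sum, ← Finset.sum_add_distrib]

/-- The mean number of arrivals which a tagged agent has to wait for is finite: she has left by the
time the market is empty. -/
lemma summable_stayProb {P : Params} (hP : P.Valid) (h e : ℕ) :
    Summable fun n => stayProb P n h e := by
  obtain ⟨v, hv0, hv⟩ := exists_foster hP
  have hb : ∀ N h e, ∑ n ∈ Finset.range N, stayProb P n h e ≤ v (h + 1 + e) := by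
    intro N
    induction N with
    | zero => intro h e; simpa using hv0 _
    | succ N ih =>
      intro h e
      rw [Finset.sum_range_succ']
      have h1 := taggedStep_le hP (g := fun y => v (y.1 + y.2)) (fun _ => hv0 _) ih h e
      rw [taggedStep_sum hP] at h1
      have h2 := hv (h + 1, e) (by simp)
      refine le_of_mul_le_mul_left ?_ hP.total_pos
      change P.total * (∑ n ∈ Finset.range N, taggedStep P (stayProb P n) h e + 1) ≤ _
      simp only at h2
      linarith
  exact summable_of_sum_range_le (fun n => stayProb_nonneg hP n h e) fun N => hb N h e

/-- Mean number of `H` agents who wait in state `x` and are still waiting after `n` arrivals. -/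
noncomputable def survivors (P : Params) (n : ℕ) (x : ℕ × ℕ) : ℝ :=
  x.1 * stayProb P n (x.1 - 1) x.2

lemma survivors_nonneg {P : Params} (hP : P.Valid) (n : ℕ) (x : ℕ × ℕ) : 0 ≤ survivors P n x :=
  mul_nonneg (Nat.cast_nonneg _) (stayProb_nonneg hP ..)

lemma survivors_le {P : Params} (hP : P.Valid) (n : ℕ) (x : ℕ × ℕ) : survivors P n x ≤ x.1 :=
  mul_le_of_le_one_right (Nat.cast_nonneg _) (stayProb_le_one hP ..)

/-- The `H` agents present after an arrival are the old ones who stayed, and the newcomer if she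
joined. -/
lemma jumpMean_survivors {P : Params} (hP : P.Valid) (n : ℕ) (x : ℕ × ℕ) :
    jumpMean P (survivors P n) x
      = P.total * survivors P (n + 1) x + joinRateH P x * stayProb P n x.1 x.2 := by
  obtain ⟨h, e⟩ := x
  rcases h with _ | h
  · simp [jumpMean, survivors]
  · have h1 := mul_taggedStep hP (stayProb P n) h e
    simp only [jumpMean, survivors, Nat.add_sub_cancel]
    push_cast
    change _ = P.total * ((h + 1) * taggedStep P (stayProb P n) h e) + _
    rw [h1]
    ring

section Little

variable {P : Params} {π : ℕ × ℕ → ℝ}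

lemma IsSteadyState.summable_queue (hP : P.Valid) (hπ : IsSteadyState P π) :
    Summable fun x => π x * (x.1 : ℝ) :=
  hπ.summable_mul_of_le_sq hP (f := fun x => (x.1 : ℝ)) (c := 1) fun x => by
    rw [abs_of_nonneg (Nat.cast_nonneg _)]
    push_cast
    nlinarith [(Nat.cast_nonneg x.1 : (0 : ℝ) ≤ x.1), (Nat.cast_nonneg x.2 : (0 : ℝ) ≤ x.2)]

lemma IsSteadyState.summable_survivors (hP : P.Valid) (hπ : IsSteadyState P π) (n : ℕ) :
    Summable fun x => π x * survivors P n x :=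
  (hπ.summable_queue hP).of_nonneg_of_le
    (fun x => mul_nonneg (hπ.nonneg x) (survivors_nonneg hP n x))
    fun x => mul_le_mul_of_nonneg_left (survivors_le hP n x) (hπ.nonneg x)

lemma IsSteadyState.hasSum_joinRateH_mul_stayProb (hP : P.Valid) (hπ : IsSteadyState P π) (n : ℕ) :
    HasSum (fun x => π x * (joinRateH P x * stayProb P n x.1 x.2))
      (P.total * (∑' x, π x * survivors P n x - ∑' x, π x * survivors P (n + 1) x)) := by
  have h0 := hπ.summable_survivors hP n
  have h1 := hπ.summable_survivors hP (n + 1)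
  have h2 := hπ.hasSum_gen hP (survivors_nonneg hP n) h0
  have h3 := h2.add ((h0.hasSum.sub h1.hasSum).mul_left P.total)
  rw [zero_add] at h3
  refine h3.congr_fun fun x => ?_
  rw [gen, jumpMean_survivors hP]
  ring

/-- Little's law, with time measured in arrivals: the rate of `H` agents joining, times their mean
waiting time, is the mean number of waiting `H` agents. -/
lemma IsSteadyState.hasSum_joinRateH_stayProb (hP : P.Valid) (hπ : IsSteadyState P π) :
    HasSum (fun n => ∑' x, π x * (joinRateH P x * stayProb P n x.1 x.2))
      (P.total * ∑' x, π x * (x.1 : ℝ)) := by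
  have hnn : ∀ n, 0 ≤ ∑' x, π x * (joinRateH P x * stayProb P n x.1 x.2) := fun n =>
    tsum_nonneg fun x => mul_nonneg (hπ.nonneg x)
      (mul_nonneg (joinRateH_nonneg hP x) (stayProb_nonneg hP ..))
  rw [hasSum_iff_tendsto_nat_of_nonneg hnn]
  have hpart : ∀ N, ∑ n ∈ Finset.range N, ∑' x, π x * (joinRateH P x * stayProb P n x.1 x.2)
      = P.total * (∑' x, π x * survivors P 0 x - ∑' x, π x * survivors P N x) := by
    intro N
    rw [← Finset.sum_range_sub' (fun n => ∑' x, π x * survivors P n x), Finset.mul_sum]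
    exact Finset.sum_congr rfl fun n _ => (hπ.hasSum_joinRateH_mul_stayProb hP n).tsum_eq
  have hlim : Tendsto (fun N => ∑' x, π x * survivors P N x) atTop (𝓝 (∑' _ : ℕ × ℕ, (0 : ℝ))) := by
    refine tendsto_tsum_of_dominated_convergence (hπ.summable_queue hP) (fun x => ?_)
      (Eventually.of_forall fun N x => ?_)
    · have := ((summable_stayProb hP (x.1 - 1) x.2).tendsto_atTop_zero.const_mul
        (x.1 : ℝ)).const_mul (π x)
      simpa [survivors] using this
    · rw [Real.norm_of_nonneg (mul_nonneg (hπ.nonneg x) (survivors_nonneg hP N x))]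
      exact mul_le_mul_of_nonneg_left (survivors_le hP N x) (hπ.nonneg x)
  rw [tsum_zero] at hlim
  have h0 : ∑' x, π x * survivors P 0 x = ∑' x, π x * (x.1 : ℝ) :=
    tsum_congr fun x => by simp [survivors, stayProb]
  simp_rw [hpart, h0]
  simpa using (hlim.const_sub (∑' x, π x * (x.1 : ℝ))).const_mul P.total

/-- Probability of `n` arrivals in a time interval of length `t`. -/
noncomputable def arrivalsProb (P : Params) (n : ℕ) (t : ℝ) : ℝ :=
  Real.exp (-(P.total * t)) * (P.total * t) ^ n / (n.factorial : ℝ)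

lemma arrivalsProb_nonneg (hP : P.Valid) (n : ℕ) {t : ℝ} (ht : 0 ≤ t) : 0 ≤ arrivalsProb P n t :=
  div_nonneg (mul_nonneg (Real.exp_pos _).le (pow_nonneg (mul_nonneg hP.total_pos.le ht) n))
    (Nat.cast_nonneg _)

lemma hasSum_arrivalsProb (P : Params) (t : ℝ) : HasSum (fun n => arrivalsProb P n t) 1 := by
  have h := (NormedSpace.expSeries_div_hasSum_exp (P.total * t)).mul_left
    (Real.exp (-(P.total * t)))
  rw [← Real.exp_eq_exp_ℝ, ← Real.exp_add, neg_add_cancel, Real.exp_zero] at h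
  refine h.congr_fun fun n => ?_
  rw [arrivalsProb, mul_div_assoc]

/-- The time spent with exactly `n` arrivals is exponential with rate `P.total`. -/
lemma lintegral_arrivalsProb (hP : P.Valid) (n : ℕ) :
    ∫⁻ t in Set.Ioi (0 : ℝ), ENNReal.ofReal (arrivalsProb P n t) = ENNReal.ofReal P.total⁻¹ := by
  have hT := hP.total_pos
  have hint : ∫ t in Set.Ioi (0 : ℝ), arrivalsProb P n t = P.total⁻¹ := by
    have h1 := Real.integral_rpow_mul_exp_neg_mul_Ioi (a := (n : ℝ) + 1) (by positivity) hT
    rw [Real.Gamma_nat_eq_factorial] at h1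
    have h2 : ∀ t, arrivalsProb P n t = P.total ^ n / n.factorial *
        (t ^ ((n : ℝ) + 1 - 1) * Real.exp (-(P.total * t))) := by
      intro t
      rw [add_sub_cancel_right, Real.rpow_natCast, arrivalsProb, mul_pow]
      ring
    simp_rw [h2]
    rw [MeasureTheory.integral_const_mul, h1, ← Nat.cast_succ, Real.rpow_natCast]
    have : (n.factorial : ℝ) ≠ 0 := by positivity
    field_simp
    rw [Nat.succ_eq_add_one, one_div, inv_pow, pow_succ]
    field_simp
  have hI : MeasureTheory.Integrable (arrivalsProb P n)
      (MeasureTheory.volume.restrict (Set.Ioi 0)) := by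
    by_contra hI
    rw [MeasureTheory.integral_undef hI] at hint
    exact (inv_pos.2 hT).ne hint
  rw [← hint, MeasureTheory.ofReal_integral_eq_lintegral_ofReal hI]
  rw [EventuallyLE, MeasureTheory.ae_restrict_iff' measurableSet_Ioi]
  exact Eventually.of_forall fun t ht => arrivalsProb_nonneg hP n (le_of_lt ht)

lemma ofReal_waitTail (hP : P.Valid) (hπ : IsSteadyState P π) {t : ℝ} (ht : 0 ≤ t) :
    ENNReal.ofReal (waitTail P π t) = ∑' n, ∑' x : ℕ × ℕ,
      ENNReal.ofReal (π x * (joinProb P .H x.1 x.2 * stayProb P n x.1 x.2)) *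
        ENNReal.ofReal (arrivalsProb P n t) := by
  have hj0 : ∀ x : ℕ × ℕ, 0 ≤ joinProb P .H x.1 x.2 := fun x => by
    rw [joinProb_eq]
    exact mul_nonneg (missProb_nonneg hP ..) (missProb_nonneg hP ..)
  have hj1 : ∀ x : ℕ × ℕ, joinProb P .H x.1 x.2 ≤ 1 := fun x => by
    rw [joinProb_eq]
    exact mul_le_one₀ (missProb_le_one hP ..) (missProb_nonneg hP ..) (missProb_le_one hP ..)
  have ha : ∀ n, 0 ≤ arrivalsProb P n t := fun n => arrivalsProb_nonneg hP n ht
  have hle : ∀ (x : ℕ × ℕ) n, arrivalsProb P n t * stayProb P n x.1 x.2 ≤ arrivalsProb P n t :=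
    fun x n => mul_le_of_le_one_right (ha n) (stayProb_le_one hP ..)
  have hnn : ∀ (x : ℕ × ℕ) n, 0 ≤ arrivalsProb P n t * stayProb P n x.1 x.2 :=
    fun x n => mul_nonneg (ha n) (stayProb_nonneg hP ..)
  have hs : ∀ x : ℕ × ℕ, Summable fun n => arrivalsProb P n t * stayProb P n x.1 x.2 := fun x =>
    (hasSum_arrivalsProb P t).summable.of_nonneg_of_le (hnn x) (hle x)
  have hs0 : ∀ x : ℕ × ℕ, 0 ≤ ∑' n, arrivalsProb P n t * stayProb P n x.1 x.2 :=
    fun x => tsum_nonneg (hnn x)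
  have hs1 : ∀ x : ℕ × ℕ, ∑' n, arrivalsProb P n t * stayProb P n x.1 x.2 ≤ 1 := fun x =>
    ((hs x).tsum_le_tsum (hle x) (hasSum_arrivalsProb P t).summable).trans
      (hasSum_arrivalsProb P t).tsum_eq.le
  have hsum : Summable fun x : ℕ × ℕ => π x * (joinProb P .H x.1 x.2 *
      ∑' n, arrivalsProb P n t * stayProb P n x.1 x.2) :=
    hπ.summable_mul_of_le (c := 1) fun x => by
      rw [abs_of_nonneg (mul_nonneg (hj0 x) (hs0 x))]
      exact mul_le_one₀ (hj1 x) (hs0 x) (hs1 x)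
  change ENNReal.ofReal (∑' x : ℕ × ℕ, π x * (joinProb P .H x.1 x.2 *
      ∑' n, arrivalsProb P n t * stayProb P n x.1 x.2)) = _
  rw [ENNReal.ofReal_tsum_of_nonneg
    (fun x => mul_nonneg (hπ.nonneg x) (mul_nonneg (hj0 x) (hs0 x))) hsum, ENNReal.tsum_comm]
  refine tsum_congr fun x => ?_
  rw [← mul_assoc, ENNReal.ofReal_mul (mul_nonneg (hπ.nonneg x) (hj0 x)),
    ENNReal.ofReal_tsum_of_nonneg (hnn x) (hs x), ← ENNReal.tsum_mul_left]
  refine tsum_congr fun n => ?_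
  rw [← ENNReal.ofReal_mul (mul_nonneg (hπ.nonneg x) (hj0 x)), ← ENNReal.ofReal_mul
    (mul_nonneg (hπ.nonneg x) (mul_nonneg (hj0 x) (stayProb_nonneg hP ..)))]
  congr 1
  ring

/-- Little's law. -/
lemma avgWait_eq (hP : P.Valid) (hπ : IsSteadyState P π) :
    avgWait P π = ENNReal.ofReal ((∑' x, π x * (x.1 : ℝ)) / P.lamH) := by
  have hlit := (hπ.hasSum_joinRateH_stayProb hP).mul_right P.lamH⁻¹
  have hinner : ∀ n, (∑' x, π x * (joinRateH P x * stayProb P n x.1 x.2)) * P.lamH⁻¹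
      = ∑' x, π x * (joinProb P .H x.1 x.2 * stayProb P n x.1 x.2) := by
    intro n
    rw [← tsum_mul_right]
    refine tsum_congr fun x => ?_
    rw [joinProb_eq, joinRateH]
    field_simp [hP.lamH_pos.ne']
  have hterm : ∀ n (x : ℕ × ℕ), 0 ≤ π x * (joinProb P .H x.1 x.2 * stayProb P n x.1 x.2) :=
    fun n x => mul_nonneg (hπ.nonneg x) (mul_nonneg (by
      rw [joinProb_eq]
      exact mul_nonneg (missProb_nonneg hP ..) (missProb_nonneg hP ..)) (stayProb_nonneg hP ..))
  have hsx : ∀ n, Summable fun x : ℕ × ℕ =>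
      π x * (joinProb P .H x.1 x.2 * stayProb P n x.1 x.2) := by
    intro n
    refine (((hπ.hasSum_joinRateH_mul_stayProb hP n).summable).mul_right P.lamH⁻¹).congr
      fun x => ?_
    rw [joinProb_eq, joinRateH]
    field_simp [hP.lamH_pos.ne']
  simp_rw [hinner] at hlit
  have hmeas : ∀ n, Measurable fun t => ENNReal.ofReal (arrivalsProb P n t) := by
    intro n
    unfold arrivalsProb
    fun_prop
  unfold avgWait
  rw [MeasureTheory.setLIntegral_congr_fun measurableSet_Ioi
    (fun t ht => ofReal_waitTail hP hπ (le_of_lt ht))]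
  rw [MeasureTheory.lintegral_tsum fun n =>
    (Measurable.tsum fun x => (hmeas n).const_mul _).aemeasurable]
  simp_rw [ENNReal.tsum_mul_right, MeasureTheory.lintegral_const_mul _ (hmeas _),
    lintegral_arrivalsProb hP]
  simp_rw [← ENNReal.ofReal_tsum_of_nonneg (hterm _) (hsx _)]
  rw [ENNReal.tsum_mul_right, ← ENNReal.ofReal_tsum_of_nonneg
    (fun n => tsum_nonneg (hterm n)) hlit.summable, hlit.tsum_eq, ← ENNReal.ofReal_mul]
  · congr 1
    field_simp [hP.total_pos.ne']
  · rw [← hlit.tsum_eq]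
    exact tsum_nonneg fun n => tsum_nonneg (hterm n)

end Little

/-! ### Matches of `H` newcomers with waiting `E` agents are rare -/

lemma mul_one_sub_pow_le {θ : ℝ} (h0 : 0 ≤ θ) (h1 : θ ≤ 1) (n : ℕ) :
    n * θ * (1 - θ) ^ n ≤ 1 := by
  have hb := one_add_mul_le_pow (a := θ) (by linarith) n
  have hr : 0 ≤ (1 - θ) ^ n := pow_nonneg (by linarith) n
  calc n * θ * (1 - θ) ^ n ≤ (1 + θ) ^ n * (1 - θ) ^ n :=
        mul_le_mul_of_nonneg_right (by linarith) hr
    _ = (1 - θ ^ 2) ^ n := by rw [← mul_pow]; ring_nf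
    _ ≤ 1 := pow_le_one₀ (by nlinarith) (by nlinarith [sq_nonneg θ])

lemma mul_missProb_le {P : Params} (hP : P.Valid) (T S : AgentType) (n : ℕ) :
    n * missProb P T S n ≤ 1 / (P.prob T * P.prob S) := by
  have hc := hP.cycleProb_pos T S
  rw [le_div_iff₀ hc]
  have := mul_one_sub_pow_le hc.le (hP.cycleProb_le T S) n
  unfold missProb
  linarith

/-- Probability that an `H` newcomer is matched with a waiting `E` agent. -/
noncomputable def matchHE (P : Params) (x : ℕ × ℕ) : ℝ :=
  missProb P .H .H x.1 * (1 - missProb P .H .E x.2)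

lemma matchHE_nonneg {P : Params} (hP : P.Valid) (x : ℕ × ℕ) : 0 ≤ matchHE P x :=
  mul_nonneg (missProb_nonneg hP ..) (sub_nonneg.2 (missProb_le_one hP ..))

lemma matchHE_le {P : Params} (hP : P.Valid) (x : ℕ × ℕ) :
    matchHE P x ≤ 1 - missProb P .H .E x.2 :=
  mul_le_of_le_one_left (sub_nonneg.2 (missProb_le_one hP ..)) (missProb_le_one hP ..)

lemma matchHE_le_one {P : Params} (hP : P.Valid) (x : ℕ × ℕ) : matchHE P x ≤ 1 :=
  (matchHE_le hP x).trans (by linarith [missProb_nonneg hP .H .E x.2])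

/-- When many `E` agents wait, an `E` newcomer is matched with high probability, which makes
`e ^ 2` decrease on average. -/
lemma gen_sq_E_le {P : Params} (hP : P.Valid) (x : ℕ × ℕ) :
    gen P (fun y => (y.2 : ℝ) ^ 2) x
      ≤ P.lamE * (2 / P.pE ^ 2 + 1) - P.lamH * (matchHE P x * x.2) := by
  have hjoin : joinRateE P x * (2 * x.2 + 1) ≤ P.lamE * (2 / P.pE ^ 2 + 1) := by
    have h1 := mul_missProb_le hP .E .E x.2
    have h2 := missProb_le_one hP .E .E x.2
    have h3 : 1 / (P.prob .E * P.prob .E) = 1 / P.pE ^ 2 := by rw [sq]; rfl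
    rw [h3] at h1
    have h4 : missProb P .E .H x.1 * missProb P .E .E x.2 ≤ missProb P .E .E x.2 :=
      mul_le_of_le_one_left (missProb_nonneg hP ..) (missProb_le_one hP ..)
    rw [joinRateE, mul_assoc]
    refine mul_le_mul_of_nonneg_left ?_ hP.lamE_pos.le
    have h5 := mul_le_mul_of_nonneg_right h4 (show (0 : ℝ) ≤ 2 * x.2 + 1 by positivity)
    have h6 : 2 / P.pE ^ 2 = 2 * (1 / P.pE ^ 2) := by ring
    rw [h6]
    linarith
  have hleave : leaveRateE P x * (((x.2 - 1 : ℕ) : ℝ) ^ 2 - (x.2 : ℝ) ^ 2)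
      ≤ - (P.lamH * (matchHE P x * x.2)) := by
    obtain ⟨h, e⟩ := x
    rcases e with _ | e
    · simp
    · have h1 : P.lamH * matchHE P (h, e + 1) ≤ leaveRateE P (h, e + 1) :=
        le_add_of_nonneg_right (mul_nonneg hP.lamE_pos.le (mul_nonneg (missProb_nonneg hP ..)
          (sub_nonneg.2 (missProb_le_one hP ..))))
      have h2 := mul_nonneg hP.lamH_pos.le (matchHE_nonneg hP (h, e + 1))
      have he : (0 : ℝ) ≤ e := Nat.cast_nonneg e
      simp only [Nat.add_sub_cancel]
      push_cast
      nlinarith [mul_le_mul_of_nonneg_right h1 (show (0 : ℝ) ≤ 2 * e + 1 by positivity),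
        mul_nonneg h2 he]
  rw [gen_eq]
  simp only [sub_self, mul_zero, zero_add, add_zero]
  push_cast
  have e1 : ((x.2 : ℝ) + 1) ^ 2 - (x.2 : ℝ) ^ 2 = 2 * x.2 + 1 := by ring
  rw [e1]
  linarith

section Drift

variable {P : Params} {π : ℕ × ℕ → ℝ}

/-- The mean rate of matches of `H` newcomers with waiting `E` agents is of order `√pH`. The drift
of `e ^ 2` bounds the mean of `e * y`, where `y` is the probability of such a match. As
`y ≤ e * pH * pE`, the second moment of `y` is of order `pH`. -/
lemma IsSteadyState.tsum_matchHE_le (hP : P.Valid) (hπ : IsSteadyState P π) :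
    P.lamH * ∑' x, π x * matchHE P x
      ≤ √P.pH * (P.lamH + P.pE * (P.lamE * (2 / P.pE ^ 2 + 1))) := by
  have hη : 0 < √P.pH := Real.sqrt_pos.2 hP.pH_pos
  have hsq : √P.pH * √P.pH = P.pH := Real.mul_self_sqrt hP.pH_pos.le
  have hs : Summable fun x => π x * (x.2 : ℝ) ^ 2 :=
    hπ.summable_mul_of_le_sq hP (f := fun x => (x.2 : ℝ) ^ 2) (c := 1) fun x => by
      rw [abs_of_nonneg (by positivity), one_mul]
      refine pow_le_pow_left₀ (by positivity) ?_ 2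
      push_cast
      linarith [(Nat.cast_nonneg x.1 : (0 : ℝ) ≤ x.1)]
  have hz := hπ.hasSum_gen hP (fun x => by positivity) hs
  have hsy : Summable fun x => π x * matchHE P x := hπ.summable_mul_of_le (c := 1) fun x => by
    rw [abs_of_nonneg (matchHE_nonneg hP x)]
    exact matchHE_le_one hP x
  have hpt : ∀ x, P.lamH * matchHE P x ≤ √P.pH * (P.lamH + P.pE * (P.lamE * (2 / P.pE ^ 2 + 1)))
      - √P.pH * P.pE * gen P (fun y => (y.2 : ℝ) ^ 2) x := by
    intro x
    set y := matchHE P x with hy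
    have hy0 : 0 ≤ y := matchHE_nonneg hP x
    have hye : y ≤ x.2 * (P.pH * P.pE) :=
      (matchHE_le hP x).trans (one_sub_missProb_le hP .H .E x.2)
    have hgen := mul_le_mul_of_nonneg_left (gen_sq_E_le hP x)
      (mul_nonneg hη.le hP.pE_pos.le)
    rw [← hy] at hgen
    -- This is `y ≤ η + y ^ 2 / η` with `η = √pH` and `y ^ 2 ≤ pH * pE * e * y`.
    have hAM : y ≤ √P.pH + √P.pH * P.pE * (y * x.2) := by
      refine le_of_mul_le_mul_left ?_ hη
      have h1 : √P.pH * (√P.pH + √P.pH * P.pE * (y * x.2))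
          = P.pH + y * (x.2 * (P.pH * P.pE)) := by
        linear_combination (1 + P.pE * (y * x.2)) * hsq
      rw [h1]
      nlinarith [mul_le_mul_of_nonneg_left hye hy0, sq_nonneg (√P.pH - y)]
    nlinarith [mul_le_mul_of_nonneg_left hAM hP.lamH_pos.le]
  have hle := hasSum_le (fun x => mul_le_mul_of_nonneg_left (hpt x) (hπ.nonneg x))
    ((hsy.hasSum.mul_left P.lamH).congr_fun fun x => by ring)
    (((hπ.sum_one.mul_right (√P.pH * (P.lamH + P.pE * (P.lamE * (2 / P.pE ^ 2 + 1))))).sub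
      (hz.mul_left (√P.pH * P.pE))).congr_fun fun x => by ring)
  linarith

/-! ### Concentration of the number of waiting `H` agents -/

/-- `exp (-ℓ)` is the value of `(1 - θ) ^ h` at `h = s`. Deviations from `s` are penalised
quadratically on the scale `1 / θ`, and linearly beyond it. -/
lemma sq_div_le_restoring {θ ℓ s : ℝ} (h0 : 0 < θ) (h1 : θ < 1)
    (hs : s * (-Real.log (1 - θ)) = ℓ) (n : ℕ) :
    Real.exp (-ℓ) * (|θ * n - θ * s| ^ 2 / (1 + |θ * n - θ * s|))
      ≤ θ * (s - n) * ((1 - θ) ^ n - Real.exp (-ℓ)) := by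
  have hpos : 0 < 1 - θ := by linarith
  set L := -Real.log (1 - θ) with hL
  have hLθ : θ ≤ L := by
    have := Real.log_le_sub_one_of_pos hpos
    linarith
  have hpow : (1 - θ) ^ n = Real.exp (-ℓ) * Real.exp ((s - n) * L) := by
    rw [← Real.exp_add, ← Real.exp_log hpos, ← Real.exp_nat_mul, ← hs, hL]
    congr 1
    ring
  have hfac : θ * (s - n) * ((1 - θ) ^ n - Real.exp (-ℓ))
      = Real.exp (-ℓ) * (θ * (s - n) * (Real.exp ((s - n) * L) - 1)) := by
    rw [hpow]
    ring
  rw [hfac]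
  refine mul_le_mul_of_nonneg_left ?_ (Real.exp_pos _).le
  set z := |θ * n - θ * s| with hz
  have hz0 : 0 ≤ z := abs_nonneg _
  rw [div_le_iff₀ (by linarith)]
  rcases le_total (n : ℝ) s with h | h
  · have hzt : z = θ * (s - n) := by
      rw [hz, abs_of_nonpos (by nlinarith)]
      ring
    have he : z ≤ Real.exp ((s - n) * L) - 1 := by
      have := Real.add_one_le_exp ((s - n) * L)
      have := mul_le_mul_of_nonneg_left hLθ (sub_nonneg.2 h)
      linarith
    rw [← hzt]
    nlinarith [mul_le_mul_of_nonneg_left he hz0, mul_nonneg hz0 (hz0.trans he)]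
  · have hzt : z = - (θ * (s - n)) := by
      rw [hz, abs_of_nonneg (by nlinarith)]
      ring
    have h2 : Real.exp ((s - n) * L) ≤ Real.exp (-z) := by
      refine Real.exp_le_exp.2 ?_
      nlinarith [mul_le_mul_of_nonneg_left hLθ (sub_nonneg.2 h)]
    have h3 : Real.exp (-z) * (1 + z) ≤ 1 := by
      have := mul_le_mul_of_nonneg_left (Real.add_one_le_exp z) (Real.exp_pos (-z)).le
      rw [← Real.exp_add, neg_add_cancel, Real.exp_zero] at this
      linarith
    have h4 : Real.exp ((s - n) * L) * (1 + z) ≤ 1 :=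
      (mul_le_mul_of_nonneg_right h2 (by linarith)).trans h3
    rw [show θ * (s - n) = -z by linarith]
    nlinarith [mul_le_mul_of_nonneg_left h4 hz0]

lemma le_add_mul_sq_div {z δ : ℝ} (hz : 0 ≤ z) (hδ : 0 < δ) :
    z ≤ δ + (1 + δ⁻¹) * (z ^ 2 / (1 + z)) := by
  have h1 : 0 < 1 + z := by linarith
  rw [← sub_nonneg]
  have h2 : δ + (1 + δ⁻¹) * (z ^ 2 / (1 + z)) - z
      = (δ ^ 2 * (1 + z) + z ^ 2 - δ * z) / (δ * (1 + z)) := by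
    field_simp
    ring
  rw [h2]
  exact div_nonneg (by nlinarith [sq_nonneg (δ - z), mul_nonneg (sq_nonneg δ) hz])
    (mul_pos hδ h1).le

lemma gen_sq_H (P : Params) (s : ℝ) (x : ℕ × ℕ) :
    gen P (fun y => ((y.1 : ℝ) - s) ^ 2) x
      = joinRateH P x + leaveRateH P x + 2 * (x.1 - s) * (joinRateH P x - leaveRateH P x) := by
  obtain ⟨h, e⟩ := x
  rw [gen_eq]
  rcases h with _ | h
  · simp only [leaveRateH_zero]
    push_cast
    ring
  · simp only [Nat.add_sub_cancel]
    push_cast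
    ring

/-- If the drift of the number `h` of waiting `H` agents is a restoring force proportional to
`(1 - θ) ^ h - exp (-ℓ)`, up to errors which are small after integration, then `θ h` has a mean
close to `ℓ`. The number `s` is the equilibrium, where `(1 - θ) ^ s = exp (-ℓ)`. -/
lemma IsSteadyState.abs_mean_sub_le (hP : P.Valid) (hπ : IsSteadyState P π) {θ ℓ a β X : ℝ}
    (h0 : 0 < θ) (h1 : θ < 1) (hℓ : 0 < ℓ) (ha : 0 < a) (hX : 0 < X)
    (hdrift : ∀ s, 0 ≤ s → θ * s ≤ ℓ → ∀ x : ℕ × ℕ, gen P (fun y => ((y.1 : ℝ) - s) ^ 2) x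
      ≤ β + 2 * s * (P.lamH * matchHE P x)
        - 2 * a * ((s - x.1) * ((1 - θ) ^ x.1 - Real.exp (-ℓ))))
    (hβ : θ * β + 2 * ℓ * (√P.pH * (P.lamH + P.pE * (P.lamE * (2 / P.pE ^ 2 + 1))))
      ≤ 2 * a * Real.exp (-ℓ) * X) :
    |θ * ∑' x, π x * (x.1 : ℝ) - ℓ| ≤ ℓ * θ + (2 * √X + X) := by
  set c := Real.exp (-ℓ) with hc
  have hc0 : 0 < c := Real.exp_pos _
  have hc1 : c ≤ 1 := Real.exp_le_one_iff.2 (by linarith)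
  have hpos : 0 < 1 - θ := by linarith
  have hLθ : θ ≤ -Real.log (1 - θ) := by
    have := Real.log_le_sub_one_of_pos hpos
    linarith
  have hL0 : 0 < -Real.log (1 - θ) := h0.trans_le hLθ
  have hLu : -Real.log (1 - θ) * (1 - θ) ≤ θ := by
    have := Real.log_le_sub_one_of_pos (inv_pos.2 hpos)
    rw [Real.log_inv] at this
    have := mul_le_mul_of_nonneg_right this hpos.le
    rw [sub_mul, inv_mul_cancel₀ hpos.ne'] at this
    linarith
  set s := ℓ / (-Real.log (1 - θ)) with hs
  have hsL : s * (-Real.log (1 - θ)) = ℓ := div_mul_cancel₀ _ hL0.ne'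
  have hs0 : 0 ≤ s := (div_pos hℓ hL0).le
  have hθs : θ * s ≤ ℓ := by
    rw [← hsL, mul_comm]
    exact mul_le_mul_of_nonneg_left hLθ hs0
  have hθs' : ℓ * (1 - θ) ≤ θ * s := by
    rw [← hsL, mul_assoc, mul_comm θ]
    exact mul_le_mul_of_nonneg_left hLu hs0
  have hsum_sq : Summable fun x => π x * ((x.1 : ℝ) - s) ^ 2 :=
    hπ.summable_mul_of_le_sq hP (f := fun x => ((x.1 : ℝ) - s) ^ 2) (c := (1 + s) ^ 2) fun x => by
      rw [abs_of_nonneg (by positivity), ← mul_pow]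
      have hx1 : (0 : ℝ) ≤ x.1 := Nat.cast_nonneg _
      have hx2 : (0 : ℝ) ≤ x.2 := Nat.cast_nonneg _
      refine sq_le_sq.2 ?_
      rw [abs_of_nonneg (show 0 ≤ (1 + s) * (((x.1 + x.2 : ℕ) : ℝ) + 1) by positivity)]
      push_cast
      refine abs_le.2 ⟨?_, ?_⟩ <;> nlinarith [mul_nonneg hs0 hx1, mul_nonneg hs0 hx2]
  have hz := hπ.hasSum_gen hP (fun x => by positivity) hsum_sq
  have hsy : Summable fun x => π x * matchHE P x := hπ.summable_mul_of_le (c := 1) fun x => by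
    rw [abs_of_nonneg (matchHE_nonneg hP x)]
    exact matchHE_le_one hP x
  have hq := hπ.summable_queue hP
  have hw : Summable fun x => π x * (θ * (s - x.1) * ((1 - θ) ^ x.1 - c)) := by
    refine Summable.of_norm_bounded ((hq.add (hπ.sum_one.summable.mul_right s))) fun x => ?_
    have hx1 : (0 : ℝ) ≤ x.1 := Nat.cast_nonneg _
    rw [Real.norm_eq_abs, abs_mul, abs_of_nonneg (hπ.nonneg x), ← mul_add]
    refine mul_le_mul_of_nonneg_left ?_ (hπ.nonneg x)
    have hr0 : 0 ≤ (1 - θ) ^ x.1 := pow_nonneg hpos.le _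
    have hr1 : (1 - θ) ^ x.1 ≤ 1 := pow_le_one₀ hpos.le (by linarith)
    rw [abs_mul, abs_mul, abs_of_pos h0]
    have ha1 : |s - x.1| ≤ x.1 + s := abs_le.2 ⟨by linarith, by linarith⟩
    have ha2 : |(1 - θ) ^ x.1 - c| ≤ 1 := abs_le.2 ⟨by linarith, by linarith⟩
    calc θ * |s - x.1| * |(1 - θ) ^ x.1 - c| ≤ 1 * (x.1 + s) * 1 := by gcongr
      _ = x.1 + s := by ring
  -- The mean drift of `(h - s) ^ 2` vanishes, which bounds the mean restoring force.
  have hwle : ∑' x, π x * (θ * (s - x.1) * ((1 - θ) ^ x.1 - c)) ≤ c * X := by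
    have hle := hasSum_le (fun x => mul_le_mul_of_nonneg_left (hdrift s hs0 hθs x) (hπ.nonneg x)) hz
      ((((hπ.sum_one.mul_right β).add (hsy.hasSum.mul_left (2 * s * P.lamH))).sub
        (hw.hasSum.mul_left (2 * a / θ))).congr_fun fun x => by field_simp)
    have hy := hπ.tsum_matchHE_le hP
    have hy0 : 0 ≤ P.lamH * ∑' x, π x * matchHE P x := mul_nonneg hP.lamH_pos.le
      (tsum_nonneg fun x => mul_nonneg (hπ.nonneg x) (matchHE_nonneg hP x))
    set W := ∑' x, π x * (θ * (s - x.1) * ((1 - θ) ^ x.1 - c))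
    set Y := ∑' x, π x * matchHE P x
    have h2 : 2 * a * W ≤ θ * β + 2 * (θ * s) * (P.lamH * Y) := by
      have h3 := mul_le_mul_of_nonneg_left hle h0.le
      have h4 : θ * (1 * β + 2 * s * P.lamH * Y - 2 * a / θ * W)
          = θ * β + 2 * (θ * s) * (P.lamH * Y) - 2 * a * W := by
        field_simp
      rw [h4] at h3
      linarith
    have h5 : θ * s * (P.lamH * Y) ≤
        ℓ * (√P.pH * (P.lamH + P.pE * (P.lamE * (2 / P.pE ^ 2 + 1)))) :=
      mul_le_mul hθs hy hy0 hℓ.le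
    refine le_of_mul_le_mul_left ?_ (show 0 < 2 * a by linarith)
    linarith
  -- Deviations of `θ h` up to `√X` are accepted, larger ones are charged to the restoring force.
  have hsX : 0 < √X := Real.sqrt_pos.2 hX
  have hzsum : Summable fun x => π x * (θ * x.1 - θ * s) :=
    ((hq.mul_left θ).sub (hπ.sum_one.summable.mul_right (θ * s))).congr fun x => by ring
  have habs : Summable fun x => π x * |θ * x.1 - θ * s| :=
    hzsum.abs.congr fun x => by rw [abs_mul, abs_of_nonneg (hπ.nonneg x)]
  have hmean : ∑' x, π x * |θ * x.1 - θ * s| ≤ 2 * √X + X := by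
    have hpt : ∀ x : ℕ × ℕ, |θ * x.1 - θ * s| ≤ √X + (1 + (√X)⁻¹) * c⁻¹ *
        (θ * (s - x.1) * ((1 - θ) ^ x.1 - c)) := by
      intro x
      refine (le_add_mul_sq_div (abs_nonneg _) hsX).trans ?_
      rw [mul_assoc (1 + (√X)⁻¹)]
      refine add_le_add_right (mul_le_mul_of_nonneg_left ?_ (by positivity)) _
      rw [inv_mul_eq_div, le_div_iff₀ hc0, mul_comm]
      exact sq_div_le_restoring h0 h1 hsL x.1
    have hR := (hπ.sum_one.mul_right √X).add (hw.hasSum.mul_left ((1 + (√X)⁻¹) * c⁻¹))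
    have hle := hasSum_le (fun x => ?_) habs.hasSum hR
    swap
    · rw [← mul_left_comm, ← mul_add]
      exact mul_le_mul_of_nonneg_left (hpt x) (hπ.nonneg x)
    refine hle.trans ?_
    have h2 := mul_le_mul_of_nonneg_left hwle (show 0 ≤ (1 + (√X)⁻¹) * c⁻¹ by positivity)
    have h3 : (1 + (√X)⁻¹) * c⁻¹ * (c * X) = X + √X := by
      have h4 : (√X)⁻¹ * X = √X := by
        rw [inv_mul_eq_div, Real.div_sqrt]
      calc (1 + (√X)⁻¹) * c⁻¹ * (c * X) = (c⁻¹ * c) * (X + (√X)⁻¹ * X) := by ring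
        _ = X + √X := by rw [inv_mul_cancel₀ hc0.ne', one_mul, h4]
    linarith
  have hdev : |θ * ∑' x, π x * (x.1 : ℝ) - θ * s| ≤ 2 * √X + X := by
    have h2 : θ * ∑' x, π x * (x.1 : ℝ) - θ * s = ∑' x, π x * (θ * x.1 - θ * s) := by
      have h3 := (hq.hasSum.mul_left θ).sub (hπ.sum_one.mul_right (θ * s))
      rw [one_mul] at h3
      exact (h3.congr_fun fun x => by ring).tsum_eq.symm
    rw [h2]
    have h3 := norm_tsum_le_tsum_norm (f := fun x => π x * (θ * x.1 - θ * s)) hzsum.norm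
    refine (h3.trans ?_).trans hmean
    refine le_of_eq (tsum_congr fun x => ?_)
    rw [Real.norm_eq_abs, abs_mul, abs_of_nonneg (hπ.nonneg x)]
  have h2 : |θ * s - ℓ| ≤ ℓ * θ := abs_le.2 ⟨by linarith, by nlinarith⟩
  calc |θ * ∑' x, π x * (x.1 : ℝ) - ℓ|
      ≤ |θ * ∑' x, π x * (x.1 : ℝ) - θ * s| + |θ * s - ℓ| := abs_sub_le _ _ _
    _ ≤ ℓ * θ + (2 * √X + X) := by linarith

end Drift

/-! ### The two regimes -/

section Regimes

variable {P : Params} {π : ℕ × ℕ → ℝ}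

lemma joinRateH_sub_leaveRateH (P : Params) (x : ℕ × ℕ) :
    joinRateH P x - leaveRateH P x
      = 2 * P.lamH * missProb P .H .H x.1 - P.lamH - P.lamE + P.lamE * missProb P .E .H x.1
        - P.lamH * matchHE P x := by
  unfold joinRateH leaveRateH matchHE
  ring

lemma joinRateH_add_leaveRateH_le (hP : P.Valid) (x : ℕ × ℕ) :
    joinRateH P x + leaveRateH P x ≤ P.total := by
  linarith [rates_sum P x, joinRateE_nonneg hP x, leaveRateE_nonneg hP x]

/-- With a majority of `E` agents, waiting `H` agents are essentially matched with `E` newcomers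
only. For `h ≤ s` the matches among `H` agents are negligible, and for `h > s` they help. -/
lemma gen_sq_H_le_of_lt (hP : P.Valid) {ℓ s : ℝ} (hs : 0 ≤ s)
    (hsℓ : P.pE * P.pH * s ≤ ℓ) (hℓ : P.lamE * Real.exp (-ℓ) = P.lamE - P.lamH) (x : ℕ × ℕ) :
    gen P (fun y => ((y.1 : ℝ) - s) ^ 2) x
      ≤ (P.total + 4 * P.lamH * (ℓ / P.pE) ^ 2) + 2 * s * (P.lamH * matchHE P x)
        - 2 * P.lamE * ((s - x.1) * ((1 - P.pE * P.pH) ^ x.1 - Real.exp (-ℓ))) := by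
  have h1 := joinRateH_add_leaveRateH_le hP x
  have hC : (1 - P.pE * P.pH) ^ x.1 = missProb P .E .H x.1 := rfl
  have hA0 : 0 ≤ 1 - missProb P .H .H x.1 := sub_nonneg.2 (missProb_le_one hP ..)
  have hA1 : 1 - missProb P .H .H x.1 ≤ x.1 * (P.pH * P.pH) := one_sub_missProb_le hP .H .H x.1
  have hy := matchHE_nonneg hP x
  have hps : P.pH * s ≤ ℓ / P.pE := by
    rw [le_div_iff₀ hP.pE_pos]
    linarith
  have hps2 : (P.pH * s) ^ 2 ≤ (ℓ / P.pE) ^ 2 :=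
    pow_le_pow_left₀ (mul_nonneg hP.pH_pos.le hs) hps 2
  have hHH : (s - x.1) * (1 - missProb P .H .H x.1) ≤ (ℓ / P.pE) ^ 2 := by
    rcases le_total (x.1 : ℝ) s with h | h
    · have h2 : 1 - missProb P .H .H x.1 ≤ s * (P.pH * P.pH) :=
        hA1.trans (mul_le_mul_of_nonneg_right h (mul_nonneg hP.pH_pos.le hP.pH_pos.le))
      have h3 : (s - x.1) * (1 - missProb P .H .H x.1) ≤ s * (s * (P.pH * P.pH)) :=
        mul_le_mul (by linarith) h2 hA0 hs
      linarith
    · have h2 : (s - x.1) * (1 - missProb P .H .H x.1) ≤ 0 :=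
        mul_nonpos_of_nonpos_of_nonneg (by linarith) hA0
      linarith [sq_nonneg (ℓ / P.pE)]
  have hHE : (s - x.1) * matchHE P x ≤ s * matchHE P x :=
    mul_le_mul_of_nonneg_right (by linarith) hy
  rw [gen_sq_H, joinRateH_sub_leaveRateH, hC]
  have e1 : 2 * (x.1 - s) * (2 * P.lamH * missProb P .H .H x.1 - P.lamH - P.lamE
        + P.lamE * missProb P .E .H x.1 - P.lamH * matchHE P x)
      = 4 * P.lamH * ((s - x.1) * (1 - missProb P .H .H x.1))
        + 2 * P.lamH * ((s - x.1) * matchHE P x)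
        - 2 * P.lamE * ((s - x.1) * (missProb P .E .H x.1 - Real.exp (-ℓ))) := by
    linear_combination (2 * (x.1 - s)) * hℓ
  rw [e1]
  have h4 := mul_le_mul_of_nonneg_left hHH (show 0 ≤ 4 * P.lamH by linarith [hP.lamH_pos])
  have h5 := mul_le_mul_of_nonneg_left hHE (show 0 ≤ 2 * P.lamH by linarith [hP.lamH_pos])
  linarith

/-- With a majority of `H` agents, so many of them wait that every `E` newcomer is matched with
one, and the surplus is matched among the `H` agents. -/
lemma gen_sq_H_le_of_gt (hP : P.Valid) {ℓ s : ℝ} (hs : 0 ≤ s)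
    (hℓ : 2 * P.lamH * Real.exp (-ℓ) = P.lamH + P.lamE) (x : ℕ × ℕ) :
    gen P (fun y => ((y.1 : ℝ) - s) ^ 2) x
      ≤ (P.total + 2 * (P.lamE / (P.pE * P.pH))) + 2 * s * (P.lamH * matchHE P x)
        - 2 * (2 * P.lamH) * ((s - x.1) * ((1 - P.pH ^ 2) ^ x.1 - Real.exp (-ℓ))) := by
  have h1 := joinRateH_add_leaveRateH_le hP x
  have hA : (1 - P.pH ^ 2) ^ x.1 = missProb P .H .H x.1 := by rw [sq]; rfl
  have hy := matchHE_nonneg hP x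
  have hC : (x.1 - s) * missProb P .E .H x.1 ≤ 1 / (P.pE * P.pH) := by
    have h2 : (x.1 : ℝ) * missProb P .E .H x.1 ≤ 1 / (P.pE * P.pH) := mul_missProb_le hP .E .H x.1
    have h3 := mul_nonneg hs (missProb_nonneg hP .E .H x.1)
    linarith
  have hHE : (s - x.1) * matchHE P x ≤ s * matchHE P x :=
    mul_le_mul_of_nonneg_right (by linarith) hy
  rw [gen_sq_H, joinRateH_sub_leaveRateH, hA]
  have e1 : 2 * (x.1 - s) * (2 * P.lamH * missProb P .H .H x.1 - P.lamH - P.lamE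
        + P.lamE * missProb P .E .H x.1 - P.lamH * matchHE P x)
      = 2 * P.lamE * ((x.1 - s) * missProb P .E .H x.1)
        + 2 * P.lamH * ((s - x.1) * matchHE P x)
        - 2 * (2 * P.lamH) * ((s - x.1) * (missProb P .H .H x.1 - Real.exp (-ℓ))) := by
    linear_combination (2 * (x.1 - s)) * hℓ
  rw [e1]
  have h4 := mul_le_mul_of_nonneg_left hC (show 0 ≤ 2 * P.lamE by linarith [hP.lamE_pos])
  have h5 := mul_le_mul_of_nonneg_left hHE (show 0 ≤ 2 * P.lamH by linarith [hP.lamH_pos])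
  have e2 : 2 * P.lamE * (1 / (P.pE * P.pH)) = 2 * (P.lamE / (P.pE * P.pH)) := by ring
  linarith

end Regimes

lemma tendsto_of_abs_sub_le {θ X m : ℝ → ℝ} {ℓ : ℝ} (hθ : Tendsto θ (𝓝[>] 0) (𝓝 0))
    (hX : Tendsto X (𝓝[>] 0) (𝓝 0))
    (h : ∀ᶠ p in 𝓝[>] (0 : ℝ), |m p - ℓ| ≤ ℓ * θ p + (2 * √(X p) + X p)) :
    Tendsto m (𝓝[>] 0) (𝓝 ℓ) := by
  have hb : Tendsto (fun p => ℓ * θ p + (2 * √(X p) + X p)) (𝓝[>] 0) (𝓝 0) := by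
    have := (hθ.const_mul ℓ).add ((hX.sqrt.const_mul 2).add hX)
    simpa using this
  rw [tendsto_iff_norm_sub_tendsto_zero]
  exact squeeze_zero' (Eventually.of_forall fun _ => norm_nonneg _) h hb

section Limits

variable {lamH lamE pE : ℝ} {π : ℝ → ℕ × ℕ → ℝ}

lemma valid_of_mem (hlamH : 0 < lamH) (hlamE : 0 < lamE) (hpE : 0 < pE) (hpE1 : pE ≤ 1) {pH : ℝ}
    (h0 : 0 < pH) (h1 : pH ≤ 1) : (⟨lamH, lamE, pH, pE⟩ : Params).Valid :=
  ⟨hlamH, hlamE, h0, h1, hpE, hpE1⟩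

lemma tendsto_queue_of_lt (hlamH : 0 < lamH) (hlamE : 0 < lamE) (hpE : 0 < pE) (hpE1 : pE ≤ 1)
    (hπ : ∀ pH : ℝ, 0 < pH → pH ≤ 1 → IsSteadyState ⟨lamH, lamE, pH, pE⟩ (π pH))
    (hlt : lamH < lamE) :
    Tendsto (fun pH => pE * pH * ∑' x, π pH x * (x.1 : ℝ)) (𝓝[>] 0)
      (𝓝 (Real.log (lamE / (lamE - lamH)))) := by
  have hd : 0 < lamE - lamH := by linarith
  set ℓ := Real.log (lamE / (lamE - lamH)) with hℓdef
  have hℓ0 : 0 < ℓ := Real.log_pos ((one_lt_div hd).2 (by linarith))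
  have hℓ : lamE * Real.exp (-ℓ) = lamE - lamH := by
    rw [hℓdef, ← Real.log_inv, Real.exp_log (by positivity), inv_div]
    field_simp
  set X : ℝ → ℝ := fun p => (pE * p * (lamH + lamE + 4 * lamH * (ℓ / pE) ^ 2)
    + 2 * ℓ * (√p * (lamH + pE * (lamE * (2 / pE ^ 2 + 1))))) / (2 * lamE * Real.exp (-ℓ)) with hX
  have hX0 : Tendsto X (𝓝[>] 0) (𝓝 0) := by
    have : Continuous X := by fun_prop
    exact (this.tendsto' 0 0 (by simp [hX])).mono_left nhdsWithin_le_nhds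
  have hθ0 : Tendsto (fun p => pE * p) (𝓝[>] 0) (𝓝 0) := by
    have : Continuous fun p => pE * p := by fun_prop
    exact (this.tendsto' 0 0 (by simp)).mono_left nhdsWithin_le_nhds
  refine tendsto_of_abs_sub_le hθ0 hX0 ?_
  filter_upwards [Ioo_mem_nhdsGT zero_lt_one] with p ⟨hp0, hp1⟩
  have hP := valid_of_mem hlamH hlamE hpE hpE1 hp0 hp1.le
  refine (hπ p hp0 hp1.le).abs_mean_sub_le hP (a := lamE)
    (β := lamH + lamE + 4 * lamH * (ℓ / pE) ^ 2) (mul_pos hpE hp0) ?_ hℓ0 hlamE ?_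
    (fun s hs hsℓ x => gen_sq_H_le_of_lt hP hs hsℓ hℓ x) ?_
  · exact (mul_le_of_le_one_left hp0.le hpE1).trans_lt hp1
  · have := Real.sqrt_pos.2 hp0
    positivity
  · exact (mul_div_cancel₀ _ (by positivity)).ge

lemma tendsto_queue_of_gt (hlamH : 0 < lamH) (hlamE : 0 < lamE) (hpE : 0 < pE) (hpE1 : pE ≤ 1)
    (hπ : ∀ pH : ℝ, 0 < pH → pH ≤ 1 → IsSteadyState ⟨lamH, lamE, pH, pE⟩ (π pH))
    (hgt : lamE < lamH) :
    Tendsto (fun pH => pH ^ 2 * ∑' x, π pH x * (x.1 : ℝ)) (𝓝[>] 0)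
      (𝓝 (Real.log (2 * lamH / (lamH + lamE)))) := by
  have hd : 0 < lamH + lamE := by linarith
  set ℓ := Real.log (2 * lamH / (lamH + lamE)) with hℓdef
  have hℓ0 : 0 < ℓ := Real.log_pos ((one_lt_div hd).2 (by linarith))
  have hℓ : 2 * lamH * Real.exp (-ℓ) = lamH + lamE := by
    rw [hℓdef, ← Real.log_inv, Real.exp_log (by positivity), inv_div]
    field_simp
  set X : ℝ → ℝ := fun p => (p ^ 2 * (lamH + lamE) + p * (2 * (lamE / pE))
    + 2 * ℓ * (√p * (lamH + pE * (lamE * (2 / pE ^ 2 + 1))))) / (2 * (2 * lamH) * Real.exp (-ℓ))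
    with hX
  have hX0 : Tendsto X (𝓝[>] 0) (𝓝 0) := by
    have : Continuous X := by fun_prop
    exact (this.tendsto' 0 0 (by simp [hX])).mono_left nhdsWithin_le_nhds
  have hθ0 : Tendsto (fun p : ℝ => p ^ 2) (𝓝[>] 0) (𝓝 0) := by
    have : Continuous fun p : ℝ => p ^ 2 := by fun_prop
    exact (this.tendsto' 0 0 (by simp)).mono_left nhdsWithin_le_nhds
  refine tendsto_of_abs_sub_le hθ0 hX0 ?_
  filter_upwards [Ioo_mem_nhdsGT zero_lt_one] with p ⟨hp0, hp1⟩
  have hP := valid_of_mem hlamH hlamE hpE hpE1 hp0 hp1.le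
  refine (hπ p hp0 hp1.le).abs_mean_sub_le hP (a := 2 * lamH)
    (β := lamH + lamE + 2 * (lamE / (pE * p))) (pow_pos hp0 2) ?_ hℓ0 (by positivity) ?_
    (fun s hs _ x => gen_sq_H_le_of_gt hP hs hℓ x) ?_
  · exact pow_lt_one₀ hp0.le hp1 two_ne_zero
  · have := Real.sqrt_pos.2 hp0
    positivity
  · have h1 : p ^ 2 * (lamH + lamE + 2 * (lamE / (pE * p)))
        = p ^ 2 * (lamH + lamE) + p * (2 * (lamE / pE)) := by
      field_simp
    rw [h1]
    exact (mul_div_cancel₀ _ (by positivity)).ge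

end Limits

end BilateralH

theorem theorem1 (lamH lamE pE : ℝ) (hlamH : 0 < lamH) (hlamE : 0 < lamE)
    (hpE : 0 < pE) (hpE1 : pE ≤ 1) :
    -- for every compatibility probability `pH` the market has exactly one steady state
    (∀ pH : ℝ, 0 < pH → pH ≤ 1 →
      ∃! π : ℕ × ℕ → ℝ, BilateralH.IsSteadyState ⟨lamH, lamE, pH, pE⟩ π) ∧
    -- and the average waiting time of `H` agents in it has the following asymptotics
    ∀ π : ℝ → ℕ × ℕ → ℝ,
      (∀ pH : ℝ, 0 < pH → pH ≤ 1 → BilateralH.IsSteadyState ⟨lamH, lamE, pH, pE⟩ (π pH)) →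
      (lamH < lamE →
        Tendsto (fun pH : ℝ => ENNReal.ofReal pH *
            BilateralH.avgWait ⟨lamH, lamE, pH, pE⟩ (π pH))
          (𝓝[>] 0) (𝓝 (ENNReal.ofReal (Real.log (lamE / (lamE - lamH)) / (pE * lamH))))) ∧
      (lamE < lamH →
        Tendsto (fun pH : ℝ => ENNReal.ofReal (pH ^ 2) *
            BilateralH.avgWait ⟨lamH, lamE, pH, pE⟩ (π pH))
          (𝓝[>] 0) (𝓝 (ENNReal.ofReal (Real.log (2 * lamH / (lamH + lamE)) / lamH)))) := by
  refine ⟨fun pH h0 h1 => BilateralH.existsUnique_isSteadyState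
    (BilateralH.valid_of_mem hlamH hlamE hpE hpE1 h0 h1),
    fun π hπ => ⟨fun hlt => ?_, fun hgt => ?_⟩⟩
  · have h := (BilateralH.tendsto_queue_of_lt hlamH hlamE hpE hpE1 hπ hlt).div_const (pE * lamH)
    refine (ENNReal.tendsto_ofReal h).congr' ?_
    filter_upwards [Ioo_mem_nhdsGT zero_lt_one] with p ⟨hp0, hp1⟩
    rw [BilateralH.avgWait_eq (BilateralH.valid_of_mem hlamH hlamE hpE hpE1 hp0 hp1.le)
      (hπ p hp0 hp1.le), ← ENNReal.ofReal_mul hp0.le]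
    congr 1
    field_simp
  · have h := (BilateralH.tendsto_queue_of_gt hlamH hlamE hpE hpE1 hπ hgt).div_const lamH
    refine (ENNReal.tendsto_ofReal h).congr' ?_
    filter_upwards [Ioo_mem_nhdsGT zero_lt_one] with p ⟨hp0, hp1⟩
    rw [BilateralH.avgWait_eq (BilateralH.valid_of_mem hlamH hlamE hpE hpE1 hp0 hp1.le)
      (hπ p hp0 hp1.le), ← ENNReal.ofReal_mul (pow_nonneg hp0.le 2)]
    congr 1
    field_simp
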